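/- Let $\mathbb{K}$ be an algebraically closed field of characteristic $\neq 2$, let $X$ be a smooth projective (connected) curve over $\mathbb{K}$, let $x\in X$ be a closed point with local ring $\mathcal{O}_{X,x}$ and maximal ideal $\mathfrak{M}$, and let $F$ be a vector bundle of rank $2$ on $X$. Let $E=\mathrm{End}_0(F)$ be the bundle of trace-free endomorphisms of $F$, with the orthogonal structure given by the trace form $(\varphi,\psi)\mapsto \mathrm{Tr}(\varphi\circ\psi)$. Write $\widehat{E}_x$ for the stalk of $E$ at $x$, $E_{2x}=\widehat{E}_x\otimes\mathcal{O}_{X,x}/\mathfrak{M}^2$, and $E_x=\mathrm{End}_0(F_x)$ for the fiber of $E$ at $x$. A Lagrangian submodule of $E_{2x}$ is an $\mathcal{O}_{X,x}/\mathfrak{M}^2$-submodule $L\subset E_{2x}$ of dimension $\dim_{\mathbb{K}}L=3$ on which the induced $\mathcal{O}_{X,x}/\mathfrak{M}^2$-valued quadratic form vanishes; $\mathrm{O}\Sigma_1$ is the set of those $L$ whose image in $E_x$ is one-dimensional. For such an $L$ let $E'=\ker(E\to E_{2x}/L)$ and let $\mathcal{H}(E,L)=E'\otimes\mathcal{O}_X(x)$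 be the orthogonal Hecke transform of $E$, with the symmetric bilinear form induced by that of $E$. Let $L\in\mathrm{O}\Sigma_1$ and let $\phi\in\mathrm{End}_0(F_x)$ be a non-zero (automatically nilpotent) endomorphism such that the image of $L$ in $E_x=\mathrm{End}_0(F_x)$ is the line $\mathbb{K}\phi$. Let $D=\mathrm{Im}(\phi)\subset F_x$ and let $F'=\ker(F\to F_x/D)$ be the Hecke transform of $F$ at $x$ with respect to $D$. Then, as orthogonal bundles (the right-hand sides being equipped with the trace form), $$\mathcal{H}(E,L)\;\cong\;\begin{cases}\mathrm{End}_0(F'(x)) & \text{if } \deg F=0,\\ \mathrm{End}_0(F') & \text{if } \deg F=1.\end{cases}$$ -/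

import Mathlib

open AlgebraicGeometry CategoryTheory TopologicalSpace Opposite

universe u

namespace OrthogonalHecke

/-! ## Sections of sheaves of modules -/

section Sections

variable {X : Scheme.{u}}

/-- Restriction of sections of an `𝒪_X`-module. -/
noncomputable def res (M : X.Modules) {V U : X.Opens} (h : V ≤ U) : Γ(M, U) →+ Γ(M, V) :=
  (M.presheaf.map (homOfLE h).op).hom

/-- Restriction of regular functions. -/
noncomputable def resO {V U : X.Opens} (h : V ≤ U) : Γ(X, U) →+* Γ(X, V) :=
  (X.presheaf.map (homOfLE h).op).hom

theorem res_smul (M : X.Modules) {V U : X.Opens} (h : V ≤ U) (a : Γ(X, U)) (s : Γ(M, U)) :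
    res M h (a • s) = resO h a • res M h s :=
  M.map_smul (homOfLE h) a s

theorem res_self (M : X.Modules) {U : X.Opens} (h : U ≤ U) (s : Γ(M, U)) : res M h s = s := by
  simp [res]

theorem res_res (M : X.Modules) {W V U : X.Opens} (h : W ≤ V) (h' : V ≤ U) (s : Γ(M, U)) :
    res M h (res M h' s) = res M (h.trans h') s := by
  have : (homOfLE (h.trans h')).op = (homOfLE h').op ≫ (homOfLE h).op := rfl
  simp [res, this]

theorem resO_resO {W V U : X.Opens} (h : W ≤ V) (h' : V ≤ U) (a : Γ(X, U)) :
    resO h (resO h' a) = resO (h.trans h') a := by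
  have : (homOfLE (h.trans h')).op = (homOfLE h').op ≫ (homOfLE h).op := rfl
  simp [resO, this]

theorem resO_self {U : X.Opens} (h : U ≤ U) (a : Γ(X, U)) : resO h a = a := by
  simp [resO]

/-- Sections that agree locally are equal. -/
theorem section_ext (M : X.Modules) {U : X.Opens} (s t : Γ(M, U))
    (h : ∀ p ∈ U, ∃ (V : X.Opens) (hV : V ≤ U), p ∈ V ∧ res M hV s = res M hV t) : s = t := by
  choose! V hV hp hst using h
  refine TopCat.Sheaf.eq_of_locally_eq' (⟨M.presheaf, M.isSheaf⟩ : TopCat.Sheaf Ab X)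
    (fun p : U ↦ V p.1) U (fun p ↦ homOfLE (hV p.1 p.2)) ?_ s t (fun p ↦ hst p.1 p.2)
  intro p hpU
  exact Opens.mem_iSup.2 ⟨⟨p, hpU⟩, hp p hpU⟩

/-- Regular functions that agree locally are equal. -/
theorem function_ext {U : X.Opens} (a b : Γ(X, U))
    (h : ∀ p ∈ U, ∃ (V : X.Opens) (hV : V ≤ U), p ∈ V ∧ resO hV a = resO hV b) : a = b := by
  choose! V hV hp hst using h
  refine TopCat.Sheaf.eq_of_locally_eq' X.sheaf
    (fun p : U ↦ V p.1) U (fun p ↦ homOfLE (hV p.1 p.2)) ?_ a b (fun p ↦ hst p.1 p.2)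
  intro p hpU
  exact Opens.mem_iSup.2 ⟨⟨p, hpU⟩, hp p hpU⟩

/-- Compatible sections glue. -/
theorem section_glue (M : X.Modules) {ι : Type u} (V : ι → X.Opens) (U : X.Opens)
    (hV : ∀ i, V i ≤ U) (hU : U ≤ iSup V) (s : ∀ i, Γ(M, V i))
    (h : ∀ i j, res M inf_le_left (s i) = res M (inf_le_right : V i ⊓ V j ≤ V j) (s j)) :
    ∃ t : Γ(M, U), ∀ i, res M (hV i) t = s i :=
  (TopCat.Sheaf.existsUnique_gluing' (⟨M.presheaf, M.isSheaf⟩ : TopCat.Sheaf Ab X)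
    V U (fun i ↦ homOfLE (hV i)) hU s (fun i j ↦ h i j)).exists

/-! ## Subsheaves given by local conditions -/

/-- The `𝒪_X`-submodule of `M` whose sections over `U` are those lying in `N U`, for a family `N`
of submodules which is stable under restriction and of local nature. -/
noncomputable def subsheaf (M : X.Modules) (N : ∀ U : X.Opens, Submodule Γ(X, U) Γ(M, U))
    (hres : ∀ (V U : X.Opens) (h : V ≤ U) (s : Γ(M, U)), s ∈ N U → res M h s ∈ N V)
    (hloc : ∀ (U : X.Opens) (s : Γ(M, U)),
      (∀ p ∈ U, ∃ (V : X.Opens) (h : V ≤ U), p ∈ V ∧ res M h s ∈ N V) → s ∈ N U) : X.Modules where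
  val := PresheafOfModules.Submodule.toPresheafOfModules (M := M.val)
    { obj := fun U ↦ N U.unop
      map := fun {U V} f s hs ↦ hres V.unop U.unop (leOfHom f.unop) s hs }
  isSheaf := by
    refine (TopCat.Presheaf.isSheaf_iff_isSheafUniqueGluing (X := X.carrier) _).2 ?_
    intro ι V s hs
    obtain ⟨t, ht⟩ := section_glue M V (iSup V) (le_iSup V) le_rfl (fun i ↦ (s i).1)
      (fun i j ↦ congrArg Subtype.val (hs i j))
    have htN : t ∈ N (iSup V) := by
      refine hloc _ _ fun p hp ↦ ?_
      obtain ⟨i, hi⟩ := Opens.mem_iSup.1 hp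
      exact ⟨V i, le_iSup V i, hi, (ht i).symm ▸ (s i).2⟩
    refine ⟨⟨t, htN⟩, fun i ↦ Subtype.ext (ht i), fun t' ht' ↦ Subtype.ext ?_⟩
    refine section_ext M _ _ fun p hp ↦ ?_
    obtain ⟨i, hi⟩ := Opens.mem_iSup.1 hp
    exact ⟨V i, le_iSup V i, hi, (congrArg Subtype.val (ht' i)).trans (ht i).symm⟩

/-! ## The sheaf of homomorphisms -/

/-- The homomorphisms `M|_U → N|_U`: families of linear maps `M(V) → N(V)`, `V ⊆ U`, compatible
with restriction. -/
noncomputable def homSections (M N : X.Modules) (U : X.Opens) :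
    AddSubgroup (∀ V : {V : X.Opens // V ≤ U}, Γ(M, V.1) →ₗ[Γ(X, V.1)] Γ(N, V.1)) where
  carrier := {f | ∀ (W V : X.Opens) (hW : W ≤ V) (hV : V ≤ U) (s : Γ(M, V)),
    res N hW (f ⟨V, hV⟩ s) = f ⟨W, hW.trans hV⟩ (res M hW s)}
  zero_mem' := fun W V hW hV s ↦ by simp
  add_mem' := fun hf hg W V hW hV s ↦ by simp [hf W V hW hV s, hg W V hW hV s]
  neg_mem' := fun hf W V hW hV s ↦ by simp [hf W V hW hV s]

noncomputable instance (M N : X.Modules) (U : X.Opens) : Module Γ(X, U) (homSections M N U) where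
  smul a f := ⟨fun V ↦ resO V.2 a • f.1 V, fun W V hW hV s ↦ by
    simp [res_smul, resO_resO, f.2 W V hW hV s]⟩
  one_smul f := by
    apply Subtype.ext; funext V
    change resO V.2 1 • f.1 V = f.1 V
    rw [map_one, one_smul]
  mul_smul a b f := by
    apply Subtype.ext; funext V
    change resO V.2 (a * b) • f.1 V = resO V.2 a • resO V.2 b • f.1 V
    rw [map_mul, mul_smul]
  smul_zero a := by
    apply Subtype.ext; funext V
    exact smul_zero (resO V.2 a)
  smul_add a f g := by
    apply Subtype.ext; funext V
    exact smul_add (resO V.2 a) (f.1 V) (g.1 V)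
  add_smul a b f := by
    apply Subtype.ext; funext V
    change resO V.2 (a + b) • f.1 V = resO V.2 a • f.1 V + resO V.2 b • f.1 V
    rw [map_add, add_smul]
  zero_smul f := by
    apply Subtype.ext; funext V
    change resO V.2 0 • f.1 V = 0
    rw [map_zero, zero_smul]

theorem homSections_smul_apply {M N : X.Modules} {U : X.Opens} (a : Γ(X, U))
    (f : homSections M N U) (V : {V : X.Opens // V ≤ U}) :
    (a • f).1 V = resO V.2 a • f.1 V := rfl

/-- Restriction of homomorphisms. -/
noncomputable def homRes (M N : X.Modules) {V U : X.Opens} (h : V ≤ U) :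
    homSections M N U →+ homSections M N V where
  toFun f := ⟨fun W ↦ f.1 ⟨W.1, W.2.trans h⟩, fun W W' hW hW' s ↦ f.2 W W' hW (hW'.trans h) s⟩
  map_zero' := rfl
  map_add' _ _ := rfl

/-- The presheaf `U ↦ Hom(M|_U, N|_U)` of abelian groups. -/
noncomputable def homPresheaf (M N : X.Modules) : X.Opensᵒᵖ ⥤ Ab.{u} where
  obj U := AddCommGrpCat.of (homSections M N U.unop)
  map f := AddCommGrpCat.ofHom (homRes M N (leOfHom f.unop))
  map_id _ := rfl
  map_comp _ _ := rfl

noncomputable instance (M N : X.Modules) (U : X.Opensᵒᵖ) :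
    Module (X.ringCatSheaf.obj.obj U) ((homPresheaf M N).obj U) :=
  inferInstanceAs (Module Γ(X, U.unop) (homSections M N U.unop))

/-- Compatible homomorphisms glue uniquely. -/
theorem homSections_glue (M N : X.Modules) {ι : Type u} (V : ι → X.Opens)
    (f : ∀ i, homSections M N (V i))
    (hf : ∀ i j, homRes M N inf_le_left (f i) =
      homRes M N (inf_le_right : V i ⊓ V j ≤ V j) (f j)) :
    ∃! g : homSections M N (iSup V), ∀ i, homRes M N (le_iSup V i) g = f i := by
  have key : ∀ (W : X.Opens) (_ : W ≤ iSup V) (t : Γ(M, W)), ∃ u : Γ(N, W), ∀ i,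
      res N (inf_le_left : W ⊓ V i ≤ W) u = (f i).1 ⟨W ⊓ V i, inf_le_right⟩
        (res M inf_le_left t) := by
    intro W hW t
    refine section_glue N (fun i ↦ W ⊓ V i) W (fun i ↦ inf_le_left) ?_
      (fun i ↦ (f i).1 ⟨W ⊓ V i, inf_le_right⟩ (res M inf_le_left t)) ?_
    · intro p hp
      obtain ⟨i, hi⟩ := Opens.mem_iSup.1 (hW hp)
      exact Opens.mem_iSup.2 ⟨i, hp, hi⟩
    · intro i j
      rw [(f i).2, (f j).2, res_res, res_res]
      have hle : (W ⊓ V i) ⊓ (W ⊓ V j) ≤ V i ⊓ V j := inf_le_inf inf_le_right inf_le_right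
      have := congrArg (fun g ↦ g.1 ⟨(W ⊓ V i) ⊓ (W ⊓ V j), hle⟩) (hf i j)
      exact LinearMap.congr_fun this (res M (inf_le_left.trans inf_le_left) t)
  have uniq : ∀ (W : X.Opens) (_ : W ≤ iSup V) (u u' : Γ(N, W)),
      (∀ i, res N (inf_le_left : W ⊓ V i ≤ W) u = res N (inf_le_left : W ⊓ V i ≤ W) u') →
      u = u' := by
    intro W hW u u' h
    refine section_ext N u u' fun p hp ↦ ?_
    obtain ⟨i, hi⟩ := Opens.mem_iSup.1 (hW hp)
    exact ⟨W ⊓ V i, inf_le_left, ⟨hp, hi⟩, h i⟩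
  choose g hg using key
  refine ⟨⟨fun W ↦
    { toFun := g W.1 W.2
      map_add' := fun s t ↦ uniq _ W.2 _ _ fun i ↦ by simp only [map_add, hg]
      map_smul' := fun a s ↦ uniq _ W.2 _ _ fun i ↦ by
        simp only [RingHom.id_apply, res_smul, map_smul, hg] }, ?_⟩, ?_, ?_⟩
  · intro W W' hW hW' s
    refine uniq W (hW.trans hW') _ _ fun i ↦ ?_
    change res N _ (res N hW (g W' hW' s)) = res N _ (g W _ (res M hW s))
    rw [hg, res_res, res_res]
    have h1 : W ⊓ V i ≤ W' ⊓ V i := inf_le_inf_right _ hW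
    have h2 := congrArg (res N h1) (hg W' hW' s i)
    rw [res_res, (f i).2, res_res] at h2
    exact h2
  · intro i
    apply Subtype.ext; funext W; apply LinearMap.ext; intro s
    refine uniq W.1 (W.2.trans (le_iSup V i)) _ _ fun j ↦ ?_
    change res N _ (g W.1 _ s) = _
    rw [hg, (f i).2]
    have hle : W.1 ⊓ V j ≤ V i ⊓ V j := inf_le_inf_right _ W.2
    have := congrArg (fun g ↦ g.1 ⟨W.1 ⊓ V j, hle⟩) (hf i j)
    exact (LinearMap.congr_fun this (res M inf_le_left s)).symm
  · intro g' hg'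
    apply Subtype.ext; funext W; apply LinearMap.ext; intro s
    refine uniq W.1 W.2 _ _ fun i ↦ ?_
    change _ = res N _ (g W.1 _ s)
    rw [hg, g'.2]
    have := congrArg (fun g ↦ g.1 ⟨W.1 ⊓ V i, inf_le_right⟩) (hg' i)
    exact LinearMap.congr_fun this (res M inf_le_left s)

/-- The sheaf `U ↦ Hom(M|_U, N|_U)`. -/
noncomputable def homSheaf (M N : X.Modules) : X.Modules where
  val := PresheafOfModules.ofPresheaf (R := X.ringCatSheaf.obj) (homPresheaf M N)
    (fun U V f a g ↦ by
      apply Subtype.ext; funext W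
      exact congrArg (fun r ↦ r • g.1 ⟨W.1, W.2.trans (leOfHom f.unop)⟩)
        (resO_resO W.2 (leOfHom f.unop) a).symm)
  isSheaf := by
    refine (TopCat.Presheaf.isSheaf_iff_isSheafUniqueGluing (X := X.carrier) _).2 ?_
    intro ι V f hf
    exact homSections_glue M N V f hf

/-- The homomorphism `M(V) → N(V)` given by a section of the sheaf of homomorphisms over `U ⊇ V`. -/
noncomputable def homApp {M N : X.Modules} {V U : X.Opens} (f : Γ(homSheaf M N, U)) (h : V ≤ U) :
    Γ(M, V) →ₗ[Γ(X, V)] Γ(N, V) :=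
  (show homSections M N U from f).1 ⟨V, h⟩

/-- Composition of sections of sheaves of homomorphisms. -/
noncomputable def homComp {M N P : X.Modules} {U : X.Opens} (g : Γ(homSheaf N P, U))
    (f : Γ(homSheaf M N, U)) : Γ(homSheaf M P, U) :=
  show homSections M P U from ⟨fun V ↦ homApp g V.2 ∘ₗ homApp f V.2, fun W V hW hV s ↦ by
    have hf := (show homSections M N U from f).2 W V hW hV s
    have hg := (show homSections N P U from g).2 W V hW hV (homApp f hV s)
    exact hg.trans (congrArg (homApp g (hW.trans hV)) hf)⟩

end Sections

/-! ## Vector bundles, trace, trace-free endomorphisms -/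

section Bundles

variable {X : Scheme.{u}}

/-- `s` is a frame of `M` over `V`: it defines an isomorphism `𝒪_V^n ≅ M|_V`, i.e. its restriction
to every open `W ⊆ V` is a basis of `M(W)` over `𝒪(W)`. -/
def IsFrame (M : X.Modules) {V : X.Opens} {n : ℕ} (s : Fin n → Γ(M, V)) : Prop :=
  ∀ (W : X.Opens) (h : W ≤ V), LinearIndependent Γ(X, W) (fun i ↦ res M h (s i)) ∧
    Submodule.span Γ(X, W) (Set.range fun i ↦ res M h (s i)) = ⊤

/-- `M` is a vector bundle (locally free sheaf) of rank `n`. -/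
def IsVectorBundle (M : X.Modules) (n : ℕ) : Prop :=
  ∀ p : X, ∃ (V : X.Opens) (s : Fin n → Γ(M, V)), p ∈ V ∧ IsFrame M s

theorem IsFrame.restrict {M : X.Modules} {V W : X.Opens} {n : ℕ} {s : Fin n → Γ(M, V)}
    (hs : IsFrame M s) (h : W ≤ V) : IsFrame M (fun i ↦ res M h (s i)) := fun W' h' ↦ by
  simpa only [res_res] using hs W' (h'.trans h)

/-- The basis of `M(W)` given by a frame over `V ⊇ W`. -/
noncomputable def IsFrame.basis {M : X.Modules} {V : X.Opens} {n : ℕ} {s : Fin n → Γ(M, V)}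
    (hs : IsFrame M s) {W : X.Opens} (h : W ≤ V) : Module.Basis (Fin n) Γ(X, W) Γ(M, W) :=
  Module.Basis.mk (hs W h).1 (hs W h).2.ge

/-- `c` is the trace of the endomorphism `f` of `M|_U`: on every open `V ⊆ U` over which `M` has
a frame, `c` restricts to the trace of `f : M(V) → M(V)`. -/
def IsTrace {M : X.Modules} {U : X.Opens} (f : Γ(homSheaf M M, U)) (c : Γ(X, U)) : Prop :=
  ∀ (V : X.Opens) (h : V ≤ U) (n : ℕ) (s : Fin n → Γ(M, V)), IsFrame M s →
    resO h c = LinearMap.trace Γ(X, V) Γ(M, V) (homApp f h)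

theorem trace_res {M : X.Modules} {U V W : X.Opens} (f : Γ(homSheaf M M, U)) (hV : V ≤ U)
    (hW : W ≤ V) {n : ℕ} (s : Fin n → Γ(M, V)) (hs : IsFrame M s) :
    resO hW (LinearMap.trace Γ(X, V) Γ(M, V) (homApp f hV)) =
      LinearMap.trace Γ(X, W) Γ(M, W) (homApp f (hW.trans hV)) := by
  have hb : ∀ i, hs.basis hW i = res M hW (hs.basis le_rfl i) := fun i ↦ by
    simp [IsFrame.basis, res_self]
  rw [LinearMap.trace_eq_matrix_trace _ (hs.basis le_rfl),
    LinearMap.trace_eq_matrix_trace _ (hs.basis hW), Matrix.trace, Matrix.trace, map_sum]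
  refine Finset.sum_congr rfl fun i _ ↦ ?_
  have h1 : homApp f (hW.trans hV) (hs.basis hW i) =
      ∑ j, resO hW ((hs.basis le_rfl).repr (homApp f hV (hs.basis le_rfl i)) j) •
        hs.basis hW j := by
    rw [hb]
    refine ((show homSections M M U from f).2 W V hW hV _).symm.trans ?_
    change res M hW (homApp f hV (hs.basis le_rfl i)) = _
    conv_lhs => rw [← (hs.basis le_rfl).sum_repr (homApp f hV (hs.basis le_rfl i))]
    simp only [map_sum, res_smul, hb]
  simp only [Matrix.diag_apply, LinearMap.toMatrix_apply]
  rw [h1, Module.Basis.repr_sum_self]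

/-- An endomorphism of a vector bundle has a trace, and only one. -/
theorem existsUnique_isTrace {M : X.Modules} {n : ℕ} (hM : IsVectorBundle M n) {U : X.Opens}
    (f : Γ(homSheaf M M, U)) : ∃! c, IsTrace f c := by
  choose V s hp hs using hM
  have hcov : U ≤ ⨆ p : U, V p.1 ⊓ U := fun p hpU ↦
    Opens.mem_iSup.2 ⟨⟨p, hpU⟩, hp p, hpU⟩
  have hf : ∀ p : X, IsFrame M (fun i ↦ res M (inf_le_left : V p ⊓ U ≤ V p) (s p i)) :=
    fun p ↦ (hs p).restrict inf_le_left
  obtain ⟨c, hc⟩ : ∃ c : Γ(X, U), ∀ p : U, resO (inf_le_right : V p.1 ⊓ U ≤ U) c =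
      LinearMap.trace Γ(X, V p.1 ⊓ U) Γ(M, V p.1 ⊓ U) (homApp f inf_le_right) :=
    (TopCat.Sheaf.existsUnique_gluing' X.sheaf (fun p : U ↦ V p.1 ⊓ U) U
    (fun p ↦ homOfLE inf_le_right) hcov
    (fun p ↦ LinearMap.trace Γ(X, V p.1 ⊓ U) Γ(M, V p.1 ⊓ U) (homApp f inf_le_right))
    (fun p q ↦ by
      refine (trace_res f inf_le_right inf_le_left _ (hf p.1)).trans ?_
      exact (trace_res f inf_le_right inf_le_right _ (hf q.1)).symm)).exists
  refine ⟨c, fun W hW m t ht ↦ ?_, fun c' hc' ↦ ?_⟩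
  · refine function_ext _ _ fun p hpW ↦ ⟨W ⊓ (V p ⊓ U), inf_le_left, ⟨hpW, hp p, hW hpW⟩, ?_⟩
    rw [trace_res f hW inf_le_left t ht, resO_resO]
    have h2 := congrArg (resO (inf_le_right : W ⊓ (V p ⊓ U) ≤ V p ⊓ U)) (hc ⟨p, hW hpW⟩)
    have h3 := trace_res f inf_le_right (inf_le_right : W ⊓ (V p ⊓ U) ≤ V p ⊓ U) _ (hf p)
    rw [← h3, ← h2, resO_resO]
  · refine function_ext _ _ fun p hpU ↦ ⟨V p ⊓ U, inf_le_right, ⟨hp p, hpU⟩, ?_⟩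
    exact (hc' _ inf_le_right _ _ (hf p)).trans (hc ⟨p, hpU⟩).symm

open Classical in
/-- The trace of an endomorphism of a vector bundle over `U`. -/
noncomputable def trace {M : X.Modules} {U : X.Opens} (f : Γ(homSheaf M M, U)) : Γ(X, U) :=
  if h : ∃ c, IsTrace f c then h.choose else 0

/-- `End₀(M)`: the sheaf of trace-free endomorphisms. -/
noncomputable def endZero (M : X.Modules) : X.Modules :=
  subsheaf (homSheaf M M)
    (fun U ↦
      { carrier := {f | IsTrace f 0}
        zero_mem' := fun V h n s _ ↦ by
          rw [map_zero]; exact (map_zero (LinearMap.trace Γ(X, V) Γ(M, V))).symm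
        add_mem' := fun {f g} hf hg V h n s hs ↦ by
          have := congrArg₂ (· + ·) (hf V h n s hs) (hg V h n s hs)
          simp only [map_zero, add_zero] at this
          rw [map_zero, this]
          exact (map_add (LinearMap.trace Γ(X, V) Γ(M, V)) (homApp f h) (homApp g h)).symm
        smul_mem' := fun a f hf V h n s hs ↦ by
          have := congrArg (resO h a • ·) (hf V h n s hs)
          simp only [map_zero, smul_zero] at this
          rw [map_zero, this]
          exact (map_smul (LinearMap.trace Γ(X, V) Γ(M, V)) (resO h a) (homApp f h)).symm })
    (fun V U h f hf W hW n s hs ↦ by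
      have := hf W (hW.trans h) n s hs
      rw [map_zero] at this ⊢
      exact this)
    (fun U f hf V hV n s hs ↦ by
      refine function_ext _ _ fun p hp ↦ ?_
      obtain ⟨W, hW, hpW, hfW⟩ := hf p (hV hp)
      refine ⟨V ⊓ W, inf_le_left, ⟨hp, hpW⟩, ?_⟩
      have h1 := hfW (V ⊓ W) inf_le_right n _ (hs.restrict inf_le_left)
      rw [trace_res f hV inf_le_left s hs, map_zero, map_zero]
      rw [map_zero] at h1
      exact h1)

/-- The endomorphism underlying a section of `End₀(M)`. -/
noncomputable def endZeroHom {M : X.Modules} {U : X.Opens} (f : Γ(endZero M, U)) :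
    Γ(homSheaf M M, U) :=
  (show {f : Γ(homSheaf M M, U) // IsTrace f 0} from f).1

/-- Families of maps `E(U) × E(U) → 𝒪(U)`, such as the symmetric bilinear forms of
orthogonal bundles. -/
def Form (E : X.Modules) : Type u := ∀ U : X.Opens, Γ(E, U) → Γ(E, U) → Γ(X, U)

/-- The trace form `(φ, ψ) ↦ Tr(φ ∘ ψ)` on `End₀(M)`. -/
noncomputable def traceForm (M : X.Modules) : Form (endZero M) :=
  fun _ f g ↦ trace (homComp (endZeroHom f) (endZeroHom g))

/-- An isomorphism of `𝒪_X`-modules that identifies the two forms. -/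
def IsometricTo {E E' : X.Modules} (b : Form E) (b' : Form E') : Prop :=
  ∃ θ : E ≅ E', ∀ (U : X.Opens) (s t : Γ(E, U)), b' U (θ.hom.app U s) (θ.hom.app U t) = b U s t

end Bundles

/-! ## Degree -/

section Degree

variable {X : Scheme.{u}}

/-- The coefficient in the function field of `s₁ ∧ ⋯ ∧ sₙ` with respect to `t₁ ∧ ⋯ ∧ tₙ`, for two
frames `s` and `t` of `M` over non-empty open subsets. -/
noncomputable def IsFrame.detCoeff [IsIntegral X] {M : X.Modules} {V W : X.Opens} {n : ℕ}
    {s : Fin n → Γ(M, V)} (_ : IsFrame M s) {t : Fin n → Γ(M, W)} (ht : IsFrame M t)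
    (hV : genericPoint X ∈ V) (hW : genericPoint X ∈ W) : X.functionField :=
  X.presheaf.germ (V ⊓ W) (genericPoint X) ⟨hV, hW⟩
    ((ht.basis inf_le_right).det fun i ↦ res M inf_le_left (s i))

theorem genericPoint_mem [IsIntegral X] {p : X} {V : X.Opens} (h : p ∈ V) :
    genericPoint X ∈ V :=
  ((genericPoint_spec X).mem_open_set_iff V.isOpen).mpr ⟨p, trivial, h⟩

open Classical in
/-- The degree of a vector bundle `M` of rank `n` on a smooth projective curve over an
algebraically closed field: the degree of the divisor of the rational section `s₁ ∧ ⋯ ∧ sₙ` of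
`det M` given by a frame `s` of `M` over a non-empty open subset. The order of that section at a
closed point `p` is computed in a frame of `M` near `p`. -/
noncomputable def degree {K : Type u} [Field K] [IsIntegral X] (π : X ⟶ Spec (.of K))
    [LocallyOfFiniteType π] (M : X.Modules) (n : ℕ) : ℤ :=
  haveI : IsLocallyNoetherian X := LocallyOfFiniteType.isLocallyNoetherian π
  if h : IsVectorBundle M n then
    ∑ᶠ p : X, X.ord
      ((h (genericPoint X)).choose_spec.choose_spec.2.detCoeff
        (h p).choose_spec.choose_spec.2
        (h (genericPoint X)).choose_spec.choose_spec.1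
        (genericPoint_mem (h p).choose_spec.choose_spec.1)) p
  else 0

end Degree

/-! ## Stalks and fibers -/

section Stalks

variable {X : Scheme.{u}}

/-- The stalk of `M` at `x`. -/
abbrev Stalk (M : X.Modules) (x : X) : Type u := ↑(M.presheaf.stalk x)

noncomputable instance (M : X.Modules) (x : X) : Module (X.presheaf.stalk x) (Stalk M x) :=
  PresheafOfModules.instModuleCarrierStalkCommRingCatCarrierAbPresheafOpensCarrier
    (R := X.presheaf) M.val x

/-- The germ at `x` of a section. -/
noncomputable def germ (M : X.Modules) {x : X} {U : X.Opens} (hx : x ∈ U) :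
    Γ(M, U) →+ Stalk M x :=
  (M.presheaf.germ U x hx).hom

/-- The germ at `x` of a regular function. -/
noncomputable def germO {x : X} {U : X.Opens} (hx : x ∈ U) : Γ(X, U) →+* X.presheaf.stalk x :=
  (X.presheaf.germ U x hx).hom

theorem germ_smul (M : X.Modules) {x : X} {U : X.Opens} (hx : x ∈ U) (a : Γ(X, U)) (s : Γ(M, U)) :
    germ M hx (a • s) = germO hx a • germ M hx s :=
  PresheafOfModules.germ_smul (R := X.presheaf) M.val x U hx a s

theorem germ_res (M : X.Modules) {x : X} {V U : X.Opens} (h : V ≤ U) (hx : x ∈ V) (s : Γ(M, U)) :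
    germ M hx (res M h s) = germ M (h hx) s :=
  TopCat.Presheaf.germ_res_apply M.presheaf (homOfLE h) x hx s

theorem germO_res {x : X} {V U : X.Opens} (h : V ≤ U) (hx : x ∈ V) (a : Γ(X, U)) :
    germO hx (resO h a) = germO (h hx) a :=
  TopCat.Presheaf.germ_res_apply X.presheaf (homOfLE h) x hx a

theorem exists_germ (M : X.Modules) {x : X} {U : X.Opens} (hx : x ∈ U) (m : Stalk M x) :
    ∃ (V : X.Opens) (_ : V ≤ U) (hV : x ∈ V) (s : Γ(M, V)), germ M hV s = m := by
  obtain ⟨V, hV, s, rfl⟩ := TopCat.Presheaf.exists_germ_eq M.presheaf m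
  exact ⟨U ⊓ V, inf_le_left, ⟨hx, hV⟩, res M inf_le_right s, germ_res M inf_le_right ⟨hx, hV⟩ s⟩

theorem exists_germO {x : X} {U : X.Opens} (hx : x ∈ U) (a : X.presheaf.stalk x) :
    ∃ (V : X.Opens) (_ : V ≤ U) (hV : x ∈ V) (s : Γ(X, V)), germO hV s = a := by
  obtain ⟨V, hV, s, rfl⟩ := TopCat.Presheaf.exists_germ_eq X.presheaf a
  exact ⟨U ⊓ V, inf_le_left, ⟨hx, hV⟩, resO inf_le_right s, germO_res inf_le_right ⟨hx, hV⟩ s⟩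

/-- A homomorphism `M|_U → N|_U` induces a linear map of stalks at every point of `U`. -/
theorem exists_stalkMap {M N : X.Modules} {x : X} {U : X.Opens} (hx : x ∈ U)
    (f : Γ(homSheaf M N, U)) :
    ∃ g : Stalk M x →ₗ[X.presheaf.stalk x] Stalk N x,
      ∀ (V : X.Opens) (hV : V ≤ U) (hxV : x ∈ V) (s : Γ(M, V)),
        g (germ M hxV s) = germ N hxV (homApp f hV s) := by
  have hnat : ∀ (W V : X.Opens) (hW : W ≤ V) (hV : V ≤ U) (s : Γ(M, V)),
      res N hW (homApp f hV s) = homApp f (hW.trans hV) (res M hW s) :=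
    fun W V hW hV s ↦ (show homSections M N U from f).2 W V hW hV s
  choose V hV hxV s hs using fun m : Stalk M x ↦ exists_germ M hx m
  have key : ∀ (W : X.Opens) (hW : W ≤ U) (hxW : x ∈ W) (t : Γ(M, W)),
      germ N (hxV (germ M hxW t)) (homApp f (hV _) (s (germ M hxW t))) =
        germ N hxW (homApp f hW t) := by
    intro W hW hxW t
    obtain ⟨Z, hxZ, i₁, i₂, h⟩ := TopCat.Presheaf.germ_eq M.presheaf x
      (hxV (germ M hxW t)) hxW _ _ (hs (germ M hxW t))
    have h' : res M (leOfHom i₁) (s (germ M hxW t)) = res M (leOfHom i₂) t := h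
    rw [← germ_res N (leOfHom i₁) hxZ, ← germ_res N (leOfHom i₂) hxZ, hnat, hnat, h']
  refine ⟨{ toFun := fun m ↦ germ N (hxV m) (homApp f (hV m) (s m)),
            map_add' := ?_, map_smul' := ?_ }, key⟩
  · intro m m'
    obtain ⟨W, hW, hxW, t, rfl⟩ := exists_germ M hx m
    obtain ⟨W', hW', hxW', t', rfl⟩ := exists_germ M hxW m'
    rw [← germ_res M hW' hxW' t, ← map_add, key _ (hW'.trans hW), key _ (hW'.trans hW),
      key _ (hW'.trans hW), map_add, map_add]
  · intro a m
    obtain ⟨W, hW, hxW, t, rfl⟩ := exists_germ M hx m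
    obtain ⟨W', hW', hxW', a', rfl⟩ := exists_germO hxW a
    rw [← germ_res M hW' hxW' t, ← germ_smul, key _ (hW'.trans hW), key _ (hW'.trans hW),
      map_smul, germ_smul, RingHom.id_apply]

/-- The linear map of stalks induced by a homomorphism `M|_U → N|_U`. -/
noncomputable def stalkMap {M N : X.Modules} {x : X} {U : X.Opens} (hx : x ∈ U)
    (f : Γ(homSheaf M N, U)) : Stalk M x →ₗ[X.presheaf.stalk x] Stalk N x :=
  (exists_stalkMap hx f).choose

/-- The maximal ideal of the local ring at `x`. -/
noncomputable abbrev maxIdeal (x : X) : Ideal (X.presheaf.stalk x) :=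
  IsLocalRing.maximalIdeal (X.presheaf.stalk x)

/-- `M_{nx} = M_x ⊗ 𝒪_x / 𝔪ⁿ`, where `M_x` is the stalk. For `n = 1` this is the fiber of `M` at
`x`. Its submodules over `𝒪_x / 𝔪ⁿ` are its submodules over `𝒪_x`. -/
abbrev ThickFiber (M : X.Modules) (x : X) (n : ℕ) : Type u :=
  Stalk M x ⧸ (maxIdeal x ^ n • ⊤ : Submodule (X.presheaf.stalk x) (Stalk M x))

/-- The class in `M_{nx}` of a section of `M` near `x`. -/
noncomputable def jet (M : X.Modules) {x : X} (n : ℕ) {U : X.Opens} (hx : x ∈ U) (s : Γ(M, U)) :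
    ThickFiber M x n :=
  Submodule.Quotient.mk (germ M hx s)

/-- The projection `M_{2x} → M_x` onto the fiber. -/
noncomputable def toFiber (M : X.Modules) (x : X) :
    ThickFiber M x 2 →ₗ[X.presheaf.stalk x] ThickFiber M x 1 :=
  Submodule.factor (Submodule.smul_mono_left (Ideal.pow_le_pow_right one_le_two))

/-- The map of fibers `M_x → N_x` induced by a homomorphism `M|_U → N|_U`. -/
noncomputable def fiberMap {M N : X.Modules} {x : X} {U : X.Opens} (hx : x ∈ U)
    (f : Γ(homSheaf M N, U)) : ThickFiber M x 1 →ₗ[X.presheaf.stalk x] ThickFiber N x 1 :=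
  Submodule.mapQ _ _ (stalkMap hx f) (by
    rw [← Submodule.map_le_iff_le_comap, Submodule.map_smul'']
    exact smul_mono_right _ le_top)

end Stalks

/-! ## Elementary transformations -/

section Elementary

variable {X : Scheme.{u}}

/-- The kernel of `M → M_{nx} / L`, for a submodule `L` of `M_{nx}`. -/
noncomputable def elementary (M : X.Modules) (x : X) (n : ℕ)
    (L : Submodule (X.presheaf.stalk x) (ThickFiber M x n)) : X.Modules :=
  subsheaf M
    (fun U ↦
      { carrier := {s | ∀ hx : x ∈ U, jet M n hx s ∈ L}
        zero_mem' := fun hx ↦ by simp [jet]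
        add_mem' := fun {s t} hs ht hx ↦ by
          have := L.add_mem (hs hx) (ht hx)
          rwa [jet, map_add]
        smul_mem' := fun a s hs hx ↦ by
          have := L.smul_mem (germO hx a) (hs hx)
          rwa [jet, germ_smul] })
    (fun V U h s hs hx ↦ by
      have := hs (h hx)
      rwa [jet, germ_res])
    (fun U s hs hx ↦ by
      obtain ⟨V, hV, hxV, hsV⟩ := hs x hx
      have := hsV hxV
      rwa [jet, germ_res] at this)

/-- The inclusion of the kernel of `M → M_{nx} / L` into `M`, on sections. -/
noncomputable def elementaryIncl {M : X.Modules} {x : X} {n : ℕ}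
    {L : Submodule (X.presheaf.stalk x) (ThickFiber M x n)} {U : X.Opens}
    (s : Γ(elementary M x n L, U)) : Γ(M, U) :=
  (show {s : Γ(M, U) // ∀ hx : x ∈ U, jet M n hx s ∈ L} from s).1

/-- `𝒪_X` as an `𝒪_X`-module. -/
noncomputable def structureSheaf (X : Scheme.{u}) : X.Modules :=
  SheafOfModules.unit X.ringCatSheaf

/-- The ideal sheaf `𝒪(-x)` of functions vanishing at `x`. -/
noncomputable def idealSheaf (x : X) : X.Modules :=
  subsheaf (structureSheaf X)
    (fun U ↦
      { carrier := {a | ∀ hx : x ∈ U, germO hx (show Γ(X, U) from a) ∈ maxIdeal x}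
        zero_mem' := fun hx ↦ by
          change germO hx (0 : Γ(X, U)) ∈ maxIdeal x
          rw [map_zero]; exact (maxIdeal x).zero_mem
        add_mem' := fun {a b} ha hb hx ↦ by
          have := (maxIdeal x).add_mem (ha hx) (hb hx)
          rw [← map_add] at this
          exact this
        smul_mem' := fun c a ha hx ↦ by
          have := (maxIdeal x).mul_mem_left (germO hx c) (ha hx)
          rw [← map_mul] at this
          exact this })
    (fun V U h a ha hx ↦ by
      have := ha (h hx)
      rw [← germO_res h hx] at this
      exact this)
    (fun U a ha hx ↦ by
      obtain ⟨V, hV, hxV, haV⟩ := ha x hx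
      have := haV hxV
      rw [← germO_res hV hxV]
      exact this)

/-- The function underlying a section of `𝒪(-x)`. -/
noncomputable def idealIncl {x : X} {U : X.Opens} (a : Γ(idealSheaf x, U)) : Γ(X, U) :=
  (show {a : Γ(X, U) // ∀ hx : x ∈ U, germO hx a ∈ maxIdeal x} from a).1

/-- The twist `M(x) = M ⊗ 𝒪(x)`, as the sheaf of homomorphisms from `𝒪(-x)` to `M`. -/
noncomputable def twist (x : X) (M : X.Modules) : X.Modules :=
  homSheaf (idealSheaf x) M

end Elementary

/-! ## Orthogonal Hecke transforms -/

section Hecke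

variable {X : Scheme.{u}}

/-- A submodule `L` of `E_{2x}` is Lagrangian for the form `b` on the bundle `E` of rank `r`: the
induced quadratic form `E_{2x} → 𝒪_x / 𝔪²` vanishes on `L`, and `dim L = r`. As the residue field
at a closed point of a curve over an algebraically closed field `K` is `K`, the dimension over `K`
is the length over `𝒪_x`. -/
def IsLagrangian {E : X.Modules} (b : Form E) (r : ℕ) (x : X)
    (L : Submodule (X.presheaf.stalk x) (ThickFiber E x 2)) : Prop :=
  (∀ (U : X.Opens) (hx : x ∈ U) (s : Γ(E, U)), jet E 2 hx s ∈ L →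
    germO hx (b U s s) ∈ maxIdeal x ^ 2) ∧
  Module.length (X.presheaf.stalk x) L = r

/-- The stratum `OΣ_i(E_{2x})`: Lagrangian submodules of `E_{2x}` whose image in the fiber `E_x`
has dimension `i`. -/
def OSigma {E : X.Modules} (b : Form E) (r : ℕ) (x : X) (i : ℕ) :
    Set (Submodule (X.presheaf.stalk x) (ThickFiber E x 2)) :=
  {L | IsLagrangian b r x L ∧ Module.length (X.presheaf.stalk x) (L.map (toFiber E x)) = i}

/-- The Hecke transform `H(E, L) = E'(x)`, where `E'` is the kernel of `E → E_{2x} / L`. -/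
noncomputable def hecke (E : X.Modules) (x : X)
    (L : Submodule (X.presheaf.stalk x) (ThickFiber E x 2)) : X.Modules :=
  twist x (elementary E x 2 L)

open Classical in
/-- The form on `H(E, L)` induced by the form `b` on `E`. Sections `s`, `t` of `H(E, L)` are
homomorphisms from `𝒪(-x)` to `E' ⊆ E`, and their product `c` is determined by
`b(s(f), t(g)) = f g c` for all local sections `f`, `g` of `𝒪(-x)`. -/
noncomputable def heckeForm {E : X.Modules} (b : Form E) (x : X)
    (L : Submodule (X.presheaf.stalk x) (ThickFiber E x 2)) : Form (hecke E x L) :=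
  fun U s t ↦
    if h : ∃ c : Γ(X, U), ∀ (V : X.Opens) (hV : V ≤ U) (f g : Γ(idealSheaf x, V)),
      b V (elementaryIncl (homApp s hV f)) (elementaryIncl (homApp t hV g)) =
        idealIncl f * idealIncl g * resO hV c
    then h.choose else 0

/-- The subset of `End(F_x)` corresponding to the image of `L` under
`End₀(F)_{2x} → End₀(F)_x ⊆ End(F_x)`. -/
def fiberImage {F : X.Modules} {x : X}
    (L : Submodule (X.presheaf.stalk x) (ThickFiber (endZero F) x 2)) :
    Set (Module.End (X.presheaf.stalk x) (ThickFiber F x 1)) :=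
  {ψ | ∃ (U : X.Opens) (hx : x ∈ U) (s : Γ(endZero F, U)),
    jet (endZero F) 2 hx s ∈ L ∧ ψ = fiberMap hx (endZeroHom s)}

end Hecke

end OrthogonalHecke

open OrthogonalHecke

/-! Both sides are lattices of rational trace-free endomorphisms of `F` that agree with `End₀(F)`
away from `x`, so the comparison is a computation near `x`. Let `t` be a uniformizer and let `e₀,
e₁` be a frame of `F` near `x` with `φ(e₁) = e₀` in the fiber. Then `F'` consists of the vectors `α
e₀ + tβ e₁`. The module `L` is forced to be the set of matrices `(a, b; c, -a)` modulo `t²` with `t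
∣ a` and `t² ∣ c`. Hence `t⁻¹E'` consists of the matrices with `a` regular, `b ∈ t⁻¹𝒪` and `c ∈ t𝒪`,
and these are exactly the trace-free endomorphisms of `F'` written in the frame `e₀, t e₁`. Traces
do not depend on the lattice, so the forms agree as well.

The shape of `L` is the geometric content (`exists_frame_of_nilpotent`,
`jet_mem_iff_of_isLagrangian`). Lift `φ` to a section `s` with jet in `L`. Isotropy and the
invertibility of 2 give a frame with `s e₁ = e₀`, so `s = (0, 1; δ, 0)`, and `tr s² = 2δ` puts `δ`
in `𝔪²`. For `f` in `L`, proportionality to `φ` in the fiber gives `a ∈ 𝔪`, and isotropy of `f` and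
of `f + s` gives `c ∈ 𝔪²`. The matrices allowed by these conditions form a module of length at most
3, so `L` is all of it.

The isomorphism is described without coordinates: `HeckeRel` pairs a section `s` of `H(E, L)`, a
homomorphism from `𝒪(-x)` to `E'`, with `f` in `End₀(F')` when `s(a)(v) = a f(v)` for all local `a`
in `𝒪(-x)` and `v` in `F'`. By `exists_iso_of_correspondence` it is enough that this relation is
locally bijective, which is read off the local model `IsModel`. Finally `isometricTo_twist` says
that twisting by `𝒪(x)` changes neither the endomorphisms nor the traces, which turns `End₀(F')`
into `End₀(F'(x))`.

The uniformizer comes from smoothness: the differentials are free of rank one, so the cotangent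
space at `x` is cyclic, and Nakayama's lemma applies (`exists_span_sup_sq`,
`exists_isLocalGenerator`). -/

namespace OrthogonalHecke

/-! ### Sections, homomorphisms, and isomorphisms from local correspondences -/

section Tools

variable {X : Scheme.{u}} {M N P : X.Modules} {U V W : X.Opens} {x : X}

theorem res_homApp (f : Γ(homSheaf M N, U)) (hV : V ≤ U) (hW : W ≤ V) (s : Γ(M, V)) :
    res N hW (homApp f hV s) = homApp f (hW.trans hV) (res M hW s) :=
  (show homSections M N U from f).2 W V hW hV s

theorem homSheaf_ext {f g : Γ(homSheaf M N, U)}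
    (h : ∀ (V : X.Opens) (hV : V ≤ U) (s : Γ(M, V)), homApp f hV s = homApp g hV s) : f = g :=
  Subtype.ext (funext fun V ↦ LinearMap.ext fun s ↦ h V.1 V.2 s)

/-- The section of the sheaf of homomorphisms given by a compatible family of linear maps. -/
noncomputable def homMk (f : ∀ V : X.Opens, V ≤ U → Γ(M, V) →ₗ[Γ(X, V)] Γ(N, V))
    (hf : ∀ (W V : X.Opens) (hW : W ≤ V) (hV : V ≤ U) (s : Γ(M, V)),
      res N hW (f V hV s) = f W (hW.trans hV) (res M hW s)) : Γ(homSheaf M N, U) :=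
  show homSections M N U from ⟨fun V ↦ f V.1 V.2, hf⟩

@[simp] theorem homApp_homMk (f : ∀ V : X.Opens, V ≤ U → Γ(M, V) →ₗ[Γ(X, V)] Γ(N, V)) (hf)
    (hV : V ≤ U) : homApp (homMk (N := N) f hf) hV = f V hV := rfl

@[simp] theorem homApp_res (f : Γ(homSheaf M N, U)) (hV : V ≤ U) (hW : W ≤ V) :
    homApp (res _ hV f) hW = homApp f (hW.trans hV) := rfl

@[simp] theorem homApp_add (f g : Γ(homSheaf M N, U)) (hV : V ≤ U) :
    homApp (f + g) hV = homApp f hV + homApp g hV := rfl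

@[simp] theorem homApp_zero (hV : V ≤ U) : homApp (0 : Γ(homSheaf M N, U)) hV = 0 := rfl

@[simp] theorem homApp_smul (a : Γ(X, U)) (f : Γ(homSheaf M N, U)) (hV : V ≤ U) :
    homApp (a • f) hV = resO hV a • homApp f hV := rfl

@[simp] theorem homApp_homComp (g : Γ(homSheaf N P, U)) (f : Γ(homSheaf M N, U)) (hV : V ≤ U) :
    homApp (homComp g f) hV = homApp g hV ∘ₗ homApp f hV := rfl

theorem endZeroHom_injective : Function.Injective (endZeroHom (M := M) (U := U)) :=
  Subtype.val_injective

theorem isTrace_endZeroHom (f : Γ(endZero M, U)) : IsTrace (endZeroHom f) 0 :=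
  (show {f : Γ(homSheaf M M, U) // IsTrace f 0} from f).2

/-- The trace-free endomorphism given by an endomorphism of trace zero. -/
noncomputable def endZeroMk (f : Γ(homSheaf M M, U)) (hf : IsTrace f 0) : Γ(endZero M, U) :=
  show {f : Γ(homSheaf M M, U) // IsTrace f 0} from ⟨f, hf⟩

@[simp] theorem endZeroHom_add (f g : Γ(endZero M, U)) :
    endZeroHom (f + g) = endZeroHom f + endZeroHom g := rfl

@[simp] theorem endZeroHom_smul (a : Γ(X, U)) (f : Γ(endZero M, U)) :
    endZeroHom (a • f) = a • endZeroHom f := rfl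

variable {n : ℕ} {L : Submodule (X.presheaf.stalk x) (ThickFiber M x n)}

theorem elementaryIncl_injective :
    Function.Injective (elementaryIncl (M := M) (x := x) (n := n) (L := L) (U := U)) :=
  Subtype.val_injective

theorem jet_elementaryIncl (s : Γ(elementary M x n L, U)) (hx : x ∈ U) :
    jet M n hx (elementaryIncl s) ∈ L :=
  (show {s : Γ(M, U) // ∀ hx : x ∈ U, jet M n hx s ∈ L} from s).2 hx

/-- The section of the kernel of `M → M_{nx} / L` given by a section of `M`. -/
noncomputable def elementaryMk (s : Γ(M, U)) (hs : ∀ hx : x ∈ U, jet M n hx s ∈ L) :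
    Γ(elementary M x n L, U) :=
  show {s : Γ(M, U) // ∀ hx : x ∈ U, jet M n hx s ∈ L} from ⟨s, hs⟩

@[simp] theorem elementaryIncl_add (s t : Γ(elementary M x n L, U)) :
    elementaryIncl (s + t) = elementaryIncl s + elementaryIncl t := rfl

@[simp] theorem elementaryIncl_zero : elementaryIncl (0 : Γ(elementary M x n L, U)) = 0 := rfl

@[simp] theorem elementaryIncl_smul (a : Γ(X, U)) (s : Γ(elementary M x n L, U)) :
    elementaryIncl (a • s) = a • elementaryIncl s := rfl

@[simp] theorem elementaryIncl_res (h : V ≤ U) (s : Γ(elementary M x n L, U)) :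
    elementaryIncl (res _ h s) = res _ h (elementaryIncl s) := rfl

theorem idealIncl_injective : Function.Injective (idealIncl (x := x) (U := U)) :=
  Subtype.val_injective

theorem germO_idealIncl (a : Γ(idealSheaf x, U)) (hx : x ∈ U) :
    germO hx (idealIncl a) ∈ maxIdeal x :=
  (show {a : Γ(X, U) // ∀ hx : x ∈ U, germO hx a ∈ maxIdeal x} from a).2 hx

/-- The section of `𝒪(-x)` given by a function vanishing at `x`. -/
noncomputable def idealMk (a : Γ(X, U)) (ha : ∀ hx : x ∈ U, germO hx a ∈ maxIdeal x) :
    Γ(idealSheaf x, U) :=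
  show {a : Γ(X, U) // ∀ hx : x ∈ U, germO hx a ∈ maxIdeal x} from ⟨a, ha⟩

@[simp] theorem idealIncl_add (a b : Γ(idealSheaf x, U)) :
    idealIncl (a + b) = idealIncl a + idealIncl b := rfl

@[simp] theorem idealIncl_smul (c : Γ(X, U)) (a : Γ(idealSheaf x, U)) :
    idealIncl (c • a) = c * idealIncl a := rfl

@[simp] theorem idealIncl_res (h : V ≤ U) (a : Γ(idealSheaf x, U)) :
    idealIncl (res _ h a) = resO h (idealIncl a) := rfl

/-- A morphism of sheaves of modules from linear maps on sections. -/
noncomputable def modulesHomMk (f : ∀ U : X.Opens, Γ(M, U) →ₗ[Γ(X, U)] Γ(N, U))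
    (hf : ∀ (V U : X.Opens) (h : V ≤ U) (s : Γ(M, U)), res N h (f U s) = f V (res M h s)) :
    M ⟶ N where
  val :=
    { app := fun U ↦ ModuleCat.ofHom (f U.unop)
      naturality := fun {U V} i ↦ by
        ext s
        exact (hf V.unop U.unop (leOfHom i.unop) s).symm }

/-- A correspondence between two sheaves of modules which is linear, of local nature and locally
the graph of a map is the graph of a morphism. -/
theorem exists_hom_of_correspondence (R : ∀ U : X.Opens, Submodule Γ(X, U) (Γ(M, U) × Γ(N, U)))
    (hres : ∀ (V U : X.Opens) (h : V ≤ U) (s : Γ(M, U)) (t : Γ(N, U)),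
      (s, t) ∈ R U → (res M h s, res N h t) ∈ R V)
    (hloc : ∀ (U : X.Opens) (s : Γ(M, U)) (t : Γ(N, U)),
      (∀ p ∈ U, ∃ (V : X.Opens) (h : V ≤ U), p ∈ V ∧ (res M h s, res N h t) ∈ R V) →
        (s, t) ∈ R U)
    (huniq : ∀ (U : X.Opens) (t : Γ(N, U)), (0, t) ∈ R U → t = 0)
    (hex : ∀ (U : X.Opens) (s : Γ(M, U)), ∀ p ∈ U, ∃ (V : X.Opens) (h : V ≤ U), p ∈ V ∧
      ∃ t : Γ(N, V), (res M h s, t) ∈ R V) :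
    ∃ θ : M ⟶ N, ∀ (U : X.Opens) (s : Γ(M, U)), (s, θ.app U s) ∈ R U := by
  have huniq' : ∀ (U : X.Opens) (s : Γ(M, U)) (t t' : Γ(N, U)), (s, t) ∈ R U → (s, t') ∈ R U →
      t = t' := fun U s t t' h h' ↦ sub_eq_zero.1 (huniq U _ (by simpa using (R U).sub_mem h h'))
  have key : ∀ (U : X.Opens) (s : Γ(M, U)), ∃ t : Γ(N, U), (s, t) ∈ R U := by
    intro U s
    choose! V hV hp t ht using hex U s
    -- Local partners agree on overlaps because a partner is unique where it exists, so they glue.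
    obtain ⟨r, hr⟩ := section_glue N (fun p : U ↦ V p.1) U (fun p ↦ hV p.1 p.2)
      (fun p hp' ↦ Opens.mem_iSup.2 ⟨⟨p, hp'⟩, hp p hp'⟩) (fun p ↦ t p.1) (fun p q ↦ by
        have h1 := hres _ _ (inf_le_left : V p.1 ⊓ V q.1 ≤ _) _ _ (ht p.1 p.2)
        have h2 := hres _ _ (inf_le_right : V p.1 ⊓ V q.1 ≤ _) _ _ (ht q.1 q.2)
        rw [res_res] at h1 h2
        exact huniq' _ _ _ _ h1 h2)
    exact ⟨r, hloc _ _ _ fun p hpU ↦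
      ⟨V p, hV p hpU, hp p hpU, by rw [hr ⟨p, hpU⟩]; exact ht p hpU⟩⟩
  choose f hf using key
  exact ⟨modulesHomMk (fun U ↦
    { toFun := f U
      map_add' := fun s s' ↦ huniq' U _ _ _ (hf U _) ((R U).add_mem (hf U s) (hf U s'))
      map_smul' := fun a s ↦ huniq' U _ _ _ (hf U _) ((R U).smul_mem a (hf U s)) })
    (fun V U h s ↦ huniq' V _ _ _ (hres V U h _ _ (hf U s)) (hf V _)), hf⟩

/-- A correspondence between two sheaves of modules which is linear, of local nature and locally
bijective is the graph of an isomorphism. -/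
theorem exists_iso_of_correspondence (R : ∀ U : X.Opens, Submodule Γ(X, U) (Γ(M, U) × Γ(N, U)))
    (hres : ∀ (V U : X.Opens) (h : V ≤ U) (s : Γ(M, U)) (t : Γ(N, U)),
      (s, t) ∈ R U → (res M h s, res N h t) ∈ R V)
    (hloc : ∀ (U : X.Opens) (s : Γ(M, U)) (t : Γ(N, U)),
      (∀ p ∈ U, ∃ (V : X.Opens) (h : V ≤ U), p ∈ V ∧ (res M h s, res N h t) ∈ R V) →
        (s, t) ∈ R U)
    (hl : ∀ (U : X.Opens) (s : Γ(M, U)), (s, 0) ∈ R U → s = 0)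
    (hr : ∀ (U : X.Opens) (t : Γ(N, U)), (0, t) ∈ R U → t = 0)
    (exl : ∀ (U : X.Opens) (s : Γ(M, U)), ∀ p ∈ U, ∃ (V : X.Opens) (h : V ≤ U), p ∈ V ∧
      ∃ t : Γ(N, V), (res M h s, t) ∈ R V)
    (exr : ∀ (U : X.Opens) (t : Γ(N, U)), ∀ p ∈ U, ∃ (V : X.Opens) (h : V ≤ U), p ∈ V ∧
      ∃ s : Γ(M, V), (s, res N h t) ∈ R V) :
    ∃ θ : M ≅ N, ∀ (U : X.Opens) (s : Γ(M, U)), (s, θ.hom.app U s) ∈ R U := by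
  obtain ⟨θ, hθ⟩ := exists_hom_of_correspondence R hres hloc hr exl
  -- The inverse is the morphism attached to the transposed relation.
  obtain ⟨η, hη⟩ := exists_hom_of_correspondence (M := N) (N := M)
    (fun U ↦ (R U).comap (LinearEquiv.prodComm Γ(X, U) Γ(N, U) Γ(M, U)).toLinearMap)
    (fun V U h s t hst ↦ hres V U h t s hst) (fun U s t hst ↦ hloc U t s hst) hl exr
  replace hη : ∀ (U : X.Opens) (t : Γ(N, U)), (η.app U t, t) ∈ R U := hη
  refine ⟨⟨θ, η, ?_, ?_⟩, hθ⟩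
  · ext U s
    refine sub_eq_zero.1 (hl U (η.app U (θ.app U s) - s) ?_)
    simpa using (R U).sub_mem (hη U (θ.app U s)) (hθ U s)
  · ext U t
    refine sub_eq_zero.1 (hr U (θ.app U (η.app U t) - t) ?_)
    simpa using (R U).sub_mem (hθ U (η.app U t)) (hη U t)

theorem IsometricTo.trans {E E' E'' : X.Modules} {b : Form E} {b' : Form E'} {b'' : Form E''}
    (h : IsometricTo b b') (h' : IsometricTo b' b'') : IsometricTo b b'' := by
  obtain ⟨θ, hθ⟩ := h
  obtain ⟨θ', hθ'⟩ := h'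
  exact ⟨θ ≪≫ θ', fun U s t ↦ (hθ' U _ _).trans (hθ U s t)⟩

end Tools

/-! ### Local computation of traces and transport of frames -/

section Trace

variable {X : Scheme.{u}} {M N : X.Modules} {U V W : X.Opens} {n : ℕ}

theorem isTrace_trace (hM : IsVectorBundle M n) (f : Γ(homSheaf M M, U)) : IsTrace f (trace f) := by
  have h := (existsUnique_isTrace hM f).exists
  rw [trace, dif_pos h]
  exact h.choose_spec

theorem IsTrace.trace_eq (hM : IsVectorBundle M n) {f : Γ(homSheaf M M, U)} {c : Γ(X, U)}
    (h : IsTrace f c) : trace f = c :=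
  (existsUnique_isTrace hM f).unique (isTrace_trace hM f) h

/-- The trace can be computed locally. -/
theorem IsTrace.of_locally (hM : IsVectorBundle M n) {f : Γ(homSheaf M M, U)} {c : Γ(X, U)}
    (h : ∀ p ∈ U, ∃ (V : X.Opens) (hV : V ≤ U), p ∈ V ∧ ∃ (m : ℕ) (s : Fin m → Γ(M, V)),
      IsFrame M s ∧ resO hV c = LinearMap.trace Γ(X, V) Γ(M, V) (homApp f hV)) : IsTrace f c := by
  have : c = trace f := function_ext _ _ fun p hp ↦ by
    obtain ⟨V, hV, hpV, m, s, hs, hc⟩ := h p hp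
    exact ⟨V, hV, hpV, hc.trans (isTrace_trace hM f V hV m s hs).symm⟩
  exact this ▸ isTrace_trace hM f

theorem IsTrace.res {f : Γ(homSheaf M M, U)} {c : Γ(X, U)} (hf : IsTrace f c) (h : V ≤ U) :
    IsTrace (res _ h f) (resO h c) := fun W hW m s hs ↦ by
  rw [resO_resO, hf W (hW.trans h) m s hs]
  rfl

theorem IsFrame.basis_apply {s : Fin n → Γ(M, V)} (hs : IsFrame M s) (h : W ≤ V) (i : Fin n) :
    hs.basis h i = OrthogonalHecke.res M h (s i) := by
  simp [IsFrame.basis]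

theorem IsFrame.repr_res {s : Fin n → Γ(M, V)} (hs : IsFrame M s) (hU : U ≤ V) (hW : W ≤ U)
    (m : Γ(M, U)) (i : Fin n) :
    (hs.basis (hW.trans hU)).repr (OrthogonalHecke.res M hW m) i =
      resO hW ((hs.basis hU).repr m i) := by
  have : OrthogonalHecke.res M hW m =
      ∑ j, resO hW ((hs.basis hU).repr m j) • hs.basis (hW.trans hU) j := by
    conv_lhs => rw [← (hs.basis hU).sum_repr m]
    simp only [map_sum, res_smul, hs.basis_apply, res_res]
  rw [this, Module.Basis.repr_sum_self]

/-- Frames are preserved by local isomorphisms. -/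
theorem IsFrame.map {s : Fin n → Γ(M, V)} (hs : IsFrame M s)
    (e : ∀ W : X.Opens, W ≤ V → Γ(M, W) ≃ₗ[Γ(X, W)] Γ(N, W))
    (he : ∀ (W : X.Opens) (h : W ≤ V) (m : Γ(M, V)),
      OrthogonalHecke.res N h (e V le_rfl m) = e W h (OrthogonalHecke.res M h m)) :
    IsFrame N (fun i ↦ e V le_rfl (s i)) := fun W h ↦ by
  simp only [he]
  refine ⟨(hs W h).1.map' (e W h).toLinearMap (e W h).ker, ?_⟩
  have : (Set.range fun i ↦ e W h (OrthogonalHecke.res M h (s i))) =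
      (e W h).toLinearMap '' Set.range fun i ↦ OrthogonalHecke.res M h (s i) := by
    rw [← Set.range_comp]; rfl
  rw [this, Submodule.span_image, (hs W h).2, Submodule.map_top, LinearEquiv.range]

end Trace

/-! ### Local generators of `𝒪(-x)` and invariance of `End₀` under twisting -/

section Generator

variable {X : Scheme.{u}} {M : X.Modules} {U V W : X.Opens} {x : X}

/-- `t` generates the ideal sheaf of `x` over `V`, freely. -/
structure IsLocalGenerator (x : X) {V : X.Opens} (t : Γ(X, V)) : Prop where
  regular : ∀ (W : X.Opens) (h : W ≤ V) (a : Γ(X, W)), resO h t * a = 0 → a = 0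
  mem_iff : ∀ (W : X.Opens) (h : W ≤ V) (a : Γ(X, W)),
    (∀ hx : x ∈ W, germO hx a ∈ maxIdeal x) ↔ resO h t ∣ a

variable {t : Γ(X, V)}

theorem IsLocalGenerator.restrict (ht : IsLocalGenerator x t) (h : W ≤ V) :
    IsLocalGenerator x (resO h t) where
  regular W' h' a ha := ht.regular W' (h'.trans h) a (by rwa [resO_resO] at ha)
  mem_iff W' h' a := by rw [resO_resO]; exact ht.mem_iff W' (h'.trans h) a

/-- The generator as a section of the ideal sheaf. -/
noncomputable def IsLocalGenerator.section (ht : IsLocalGenerator x t) (h : W ≤ V) :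
    Γ(idealSheaf x, W) :=
  idealMk (resO h t) ((ht.mem_iff W h _).2 dvd_rfl)

theorem IsLocalGenerator.idealIncl_section (ht : IsLocalGenerator x t) (h : W ≤ V) :
    idealIncl (ht.section h) = resO h t := rfl

theorem IsLocalGenerator.res_section (ht : IsLocalGenerator x t) (h : W ≤ V) (h' : U ≤ W) :
    res _ h' (ht.section h) = ht.section (h'.trans h) :=
  idealIncl_injective (resO_resO h' h t)

theorem IsLocalGenerator.cancel (ht : IsLocalGenerator x t) (h : W ≤ V) {a b : Γ(X, W)}
    (hab : resO h t * a = resO h t * b) : a = b :=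
  sub_eq_zero.1 (ht.regular W h _ (by rw [mul_sub, hab, sub_self]))

theorem IsLocalGenerator.exists_eq_smul (ht : IsLocalGenerator x t) (h : W ≤ V)
    (a : Γ(idealSheaf x, W)) : ∃ c : Γ(X, W), a = c • ht.section h := by
  obtain ⟨c, hc⟩ := (ht.mem_iff W h _).1 (germO_idealIncl a)
  exact ⟨c, idealIncl_injective (hc.trans (mul_comm _ _))⟩

theorem IsLocalGenerator.smul_section_injective (ht : IsLocalGenerator x t) (h : W ≤ V)
    {a b : Γ(X, W)} (hab : a • ht.section h = b • ht.section h) : a = b :=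
  ht.cancel h (by simpa [mul_comm, ht.idealIncl_section] using congrArg idealIncl hab)

/-- The homomorphism `𝒪(-x) → M` given by a section of the twist. -/
noncomputable def twistApp (s : Γ(twist x M, U)) (h : V ≤ U) :
    Γ(idealSheaf x, V) →ₗ[Γ(X, V)] Γ(M, V) :=
  homApp (M := idealSheaf x) (N := M) s h

theorem twistApp_zero (h : V ≤ U) : twistApp (0 : Γ(twist x M, U)) h = 0 := rfl

theorem twistApp_smul (a : Γ(X, U)) (s : Γ(twist x M, U)) (h : V ≤ U) :
    twistApp (a • s) h = resO h a • twistApp s h := rfl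

theorem res_twistApp (s : Γ(twist x M, U)) (h : V ≤ U) (h' : W ≤ V) (a : Γ(idealSheaf x, V)) :
    res M h' (twistApp s h a) = twistApp s (h'.trans h) (res _ h' a) :=
  res_homApp (M := idealSheaf x) (N := M) s h h' a

theorem twist_ext {s s' : Γ(twist x M, U)}
    (h : ∀ (V : X.Opens) (hV : V ≤ U) (a : Γ(idealSheaf x, V)), twistApp s hV a = twistApp s' hV a) :
    s = s' :=
  homSheaf_ext (M := idealSheaf x) (N := M) h

/-- The section of the twist with a given value at the generator. -/
theorem IsLocalGenerator.exists_twist (ht : IsLocalGenerator x t) (h : W ≤ V) (m : Γ(M, W)) :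
    ∃ s : Γ(twist x M, W), twistApp s le_rfl (ht.section h) = m := by
  -- `c` is division by `t`, well defined because `t` is regular; the section sought is `a ↦ (a / t)
  -- m`.
  choose c hc using fun (W' : X.Opens) (h' : W' ≤ W) ↦ ht.exists_eq_smul (h'.trans h)
  refine ⟨homMk (M := idealSheaf x) (N := M) (fun W' h' ↦
    { toFun := fun a ↦ c W' h' a • res M h' m
      map_add' := fun a b ↦ ?_
      map_smul' := fun a b ↦ ?_ }) ?_, ?_⟩
  · rw [← add_smul]
    congr 1
    apply ht.smul_section_injective (h'.trans h)
    rw [add_smul, ← hc, ← hc, ← hc]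
  · rw [RingHom.id_apply, smul_smul]
    congr 1
    apply ht.smul_section_injective (h'.trans h)
    rw [mul_smul, ← hc, ← hc]
  · intro W₁ W₂ h₁ h₂ a
    change res M h₁ (c W₂ h₂ a • res M h₂ m) = c W₁ _ (res _ h₁ a) • res M _ m
    rw [res_smul, res_res]
    congr 1
    apply ht.smul_section_injective (h₁.trans (h₂.trans h))
    rw [← hc, ← ht.res_section (h₂.trans h) h₁, ← res_smul, ← hc]
  · change c W le_rfl (ht.section h) • res M le_rfl m = m
    have : c W le_rfl (ht.section h) = 1 := by
      apply ht.smul_section_injective h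
      rw [one_smul]
      exact (hc W le_rfl _).symm
    rw [this, one_smul, res_self]

/-- Where `𝒪(-x)` is generated by `t`, a section of `M(x)` is determined by its value at `t`. -/
noncomputable def IsLocalGenerator.twistEquiv (ht : IsLocalGenerator x t) (M : X.Modules)
    (h : W ≤ V) : Γ(twist x M, W) ≃ₗ[Γ(X, W)] Γ(M, W) :=
  LinearEquiv.ofBijective
    { toFun := fun s ↦ twistApp s le_rfl (ht.section h)
      map_add' := fun s s' ↦ rfl
      map_smul' := fun a s ↦ by
        rw [twistApp_smul, resO_self]; rfl }
    ⟨(injective_iff_map_eq_zero _).2 fun s hs ↦ twist_ext fun W' h' a ↦ by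
      replace hs : twistApp s le_rfl (ht.section h) = 0 := hs
      obtain ⟨c, rfl⟩ := ht.exists_eq_smul (h'.trans h) a
      rw [map_smul, map_smul, ← ht.res_section h h', ← res_twistApp s le_rfl h', hs, map_zero,
        twistApp_zero, LinearMap.zero_apply], fun m ↦ ht.exists_twist h m⟩

theorem IsLocalGenerator.twistEquiv_apply (ht : IsLocalGenerator x t) (h : W ≤ V)
    (s : Γ(twist x M, W)) : ht.twistEquiv M h s = twistApp s le_rfl (ht.section h) := rfl

theorem IsLocalGenerator.res_twistEquiv (ht : IsLocalGenerator x t) (h : W ≤ V) (h' : U ≤ W)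
    (s : Γ(twist x M, W)) :
    res M h' (ht.twistEquiv M h s) = ht.twistEquiv M (h'.trans h) (res _ h' s) := by
  rw [twistEquiv_apply, twistEquiv_apply, res_twistApp, ht.res_section]
  rfl

theorem IsLocalGenerator.res_twistEquiv_symm (ht : IsLocalGenerator x t) (h : W ≤ V) (h' : U ≤ W)
    (m : Γ(M, W)) : res _ h' ((ht.twistEquiv M h).symm m) =
      (ht.twistEquiv M (h'.trans h)).symm (res M h' m) := by
  rw [LinearEquiv.eq_symm_apply, ← ht.res_twistEquiv h h', LinearEquiv.apply_symm_apply]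

theorem IsVectorBundle.exists_frame_of_generator {n : ℕ} (hM : IsVectorBundle M n)
    (hgen : ∀ p : X, ∃ (V : X.Opens) (t : Γ(X, V)), p ∈ V ∧ IsLocalGenerator x t)
    {U : X.Opens} (p : X) (hp : p ∈ U) :
    ∃ (V : X.Opens) (_ : V ≤ U) (t : Γ(X, V)) (s : Fin n → Γ(M, V)), p ∈ V ∧
      IsLocalGenerator x t ∧ IsFrame M s := by
  obtain ⟨V, t, hpV, ht⟩ := hgen p
  obtain ⟨W, s, hpW, hs⟩ := hM p
  exact ⟨U ⊓ (V ⊓ W), inf_le_left, _, _, ⟨hp, hpV, hpW⟩,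
    ht.restrict (inf_le_right.trans inf_le_left), hs.restrict (inf_le_right.trans inf_le_right)⟩

theorem IsLocalGenerator.isFrame_twist (ht : IsLocalGenerator x t) {n : ℕ} {s : Fin n → Γ(M, V)}
    (hs : IsFrame M s) : IsFrame (twist x M) (fun i ↦ (ht.twistEquiv M le_rfl).symm (s i)) :=
  hs.map (fun _ h ↦ (ht.twistEquiv M h).symm) fun _ h m ↦ ht.res_twistEquiv_symm le_rfl h m

theorem IsVectorBundle.twist {n : ℕ} (hM : IsVectorBundle M n)
    (hgen : ∀ p : X, ∃ (V : X.Opens) (t : Γ(X, V)), p ∈ V ∧ IsLocalGenerator x t) :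
    IsVectorBundle (twist x M) n := fun p ↦ by
  obtain ⟨V, -, t, s, hp, ht, hs⟩ := hM.exists_frame_of_generator hgen (U := ⊤) p trivial
  exact ⟨V, _, hp, ht.isFrame_twist hs⟩

/-- The endomorphism `f` of `M(x)` is induced by the endomorphism `g` of `M`. -/
def IsTwistOf (g : Γ(homSheaf M M, U)) (f : Γ(homSheaf (twist x M) (twist x M), U)) : Prop :=
  ∀ (V : X.Opens) (hV : V ≤ U) (v : Γ(OrthogonalHecke.twist x M, V)) (W : X.Opens) (hW : W ≤ V)
    (b : Γ(idealSheaf x, W)),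
    twistApp (homApp f hV v) hW b = homApp g (hW.trans hV) (twistApp v hW b)

theorem IsTwistOf.comp {g g' : Γ(homSheaf M M, U)} {f f' : Γ(homSheaf (twist x M) (twist x M), U)}
    (h : IsTwistOf g f) (h' : IsTwistOf g' f') : IsTwistOf (homComp g g') (homComp f f') :=
  fun V hV v W hW b ↦ (h V hV _ W hW b).trans (congrArg _ (h' V hV v W hW b))

theorem IsTwistOf.res {g : Γ(homSheaf M M, U)} {f : Γ(homSheaf (twist x M) (twist x M), U)}
    (h : IsTwistOf g f) (hV : V ≤ U) :
    IsTwistOf (OrthogonalHecke.res _ hV g) (OrthogonalHecke.res _ hV f) :=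
  fun W hW v => h W (hW.trans hV) v

/-- Evaluation at `t` identifies `M(x)` with `M` locally and conjugates `f` into `g`; traces are
invariant under conjugation. -/
theorem IsTwistOf.linearMap_trace (ht : IsLocalGenerator x t) (hV : V ≤ U)
    {g : Γ(homSheaf M M, U)} {f : Γ(homSheaf (twist x M) (twist x M), U)} (h : IsTwistOf g f) :
    LinearMap.trace Γ(X, V) Γ(OrthogonalHecke.twist x M, V) (homApp f hV) =
      LinearMap.trace Γ(X, V) Γ(M, V) (homApp g hV) := by
  rw [← LinearMap.trace_conj' (homApp f hV) (ht.twistEquiv M le_rfl)]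
  congr 1
  ext m
  simp only [LinearEquiv.conj_apply_apply]
  rw [ht.twistEquiv_apply, h V hV, ← ht.twistEquiv_apply, LinearEquiv.apply_symm_apply]

theorem IsTwistOf.isTrace_iff {n : ℕ} (hM : IsVectorBundle M n)
    (hgen : ∀ p : X, ∃ (V : X.Opens) (t : Γ(X, V)), p ∈ V ∧ IsLocalGenerator x t)
    {g : Γ(homSheaf M M, U)} {f : Γ(homSheaf (twist x M) (twist x M), U)} (h : IsTwistOf g f)
    {c : Γ(X, U)} : IsTrace f c ↔ IsTrace g c := by
  constructor
  · refine fun hc ↦ .of_locally hM fun p hp ↦ ?_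
    obtain ⟨V, hV, t, s, hpV, ht, hs⟩ := hM.exists_frame_of_generator hgen p hp
    exact ⟨V, hV, hpV, n, s, hs,
      (hc V hV n _ (ht.isFrame_twist hs)).trans (h.linearMap_trace ht hV)⟩
  · refine fun hc ↦ .of_locally (hM.twist hgen) fun p hp ↦ ?_
    obtain ⟨V, hV, t, s, hpV, ht, hs⟩ := hM.exists_frame_of_generator hgen p hp
    exact ⟨V, hV, hpV, n, _, ht.isFrame_twist hs,
      (hc V hV n s hs).trans (h.linearMap_trace ht hV).symm⟩

/-- Every endomorphism of `M` induces one of `M(x)`. -/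
theorem exists_isTwistOf_right (g : Γ(homSheaf M M, U)) :
    ∃ f : Γ(homSheaf (twist x M) (twist x M), U), IsTwistOf g f :=
  ⟨homMk (fun _ hV ↦
    { toFun := fun v ↦ homComp (M := idealSheaf x) (OrthogonalHecke.res _ hV g) v
      map_add' := fun _ _ ↦ twist_ext fun _ hW _ ↦ map_add (homApp g (hW.trans hV)) _ _
      map_smul' := fun _ _ ↦ twist_ext fun _ hW _ ↦ map_smul (homApp g (hW.trans hV)) _ _ })
    fun _ _ _ _ _ ↦ rfl, fun _ _ _ _ _ _ ↦ rfl⟩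

/-- Every endomorphism of `M(x)` is induced locally by one of `M`. -/
theorem IsLocalGenerator.exists_isTwistOf_left (ht : IsLocalGenerator x t)
    (f : Γ(homSheaf (twist x M) (twist x M), V)) : ∃ g : Γ(homSheaf M M, V), IsTwistOf g f := by
  refine ⟨homMk (fun W hW ↦ (ht.twistEquiv M hW).conj (homApp f hW)) fun W' W h' h s ↦ ?_,
    fun W hW v W' hW' b ↦ ?_⟩
  · rw [LinearEquiv.conj_apply_apply, LinearEquiv.conj_apply_apply, ht.res_twistEquiv, res_homApp,
      ht.res_twistEquiv_symm]
  · obtain ⟨c, rfl⟩ := ht.exists_eq_smul (hW'.trans hW) b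
    rw [homApp_homMk, map_smul, map_smul, map_smul]
    congr 1
    have h1 : twistApp v hW' (ht.section (hW'.trans hW)) =
      ht.twistEquiv M (hW'.trans hW) (OrthogonalHecke.res _ hW' v) := rfl
    rw [h1, LinearEquiv.conj_apply_apply, LinearEquiv.symm_apply_apply, ← res_homApp f hW hW']
    rfl

theorem IsTwistOf.eq_zero_right {f : Γ(homSheaf (twist x M) (twist x M), U)}
    (h : IsTwistOf 0 f) : f = 0 :=
  homSheaf_ext fun V hV v ↦ twist_ext fun W hW b ↦ h V hV v W hW b

/-- Locally every section of `M` is the value at the generator of some section of `M(x)`, so `g` is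
seen entirely through its action on `M(x)`. -/
theorem IsTwistOf.eq_zero_left
    (hgen : ∀ p : X, ∃ (V : X.Opens) (t : Γ(X, V)), p ∈ V ∧ IsLocalGenerator x t)
    {g : Γ(homSheaf M M, U)} (h : IsTwistOf (x := x) g 0) : g = 0 := by
  refine homSheaf_ext fun V hV m ↦ section_ext _ _ _ fun p hp ↦ ?_
  obtain ⟨W, t, hpW, ht⟩ := hgen p
  refine ⟨V ⊓ W, inf_le_left, ⟨hp, hpW⟩, ?_⟩
  rw [res_homApp, ← (ht.twistEquiv M inf_le_right).apply_symm_apply (OrthogonalHecke.res M _ m),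
    ht.twistEquiv_apply, ← h _ (inf_le_left.trans hV) _ _ le_rfl]
  simp only [homApp_zero, LinearMap.zero_apply, map_zero, twistApp_zero]

/-- `End₀(M(x))` is isometric to `End₀(M)`. -/
theorem isometricTo_twist {n : ℕ} (hM : IsVectorBundle M n)
    (hgen : ∀ p : X, ∃ (V : X.Opens) (t : Γ(X, V)), p ∈ V ∧ IsLocalGenerator x t) :
    IsometricTo (traceForm M) (traceForm (twist x M)) := by
  obtain ⟨θ, hθ⟩ := exists_iso_of_correspondence (M := endZero M) (N := endZero (twist x M))
    (fun U ↦
      { carrier := {q | IsTwistOf (endZeroHom q.1) (endZeroHom q.2)}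
        zero_mem' := fun V hV v W hW b ↦ rfl
        add_mem' := fun {q q'} h h' V hV v W hW b ↦ congrArg₂ (· + ·) (h V hV v W hW b)
          (h' V hV v W hW b)
        smul_mem' := fun a q h V hV v W hW b ↦ by
          have := congrArg (resO (hW.trans hV) a • ·) (h V hV v W hW b)
          rw [← resO_resO hW hV a] at this
          exact this.trans (by rw [resO_resO]; rfl) })
    (fun V U h g f hgf ↦ hgf.res h)
    (fun U g f h V hV v W hW b ↦ by
      refine section_ext _ _ _ fun p hp ↦ ?_
      obtain ⟨Z, hZ, hpZ, hgf⟩ := h p (hV (hW hp))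
      refine ⟨W ⊓ Z, inf_le_left, ⟨hp, hpZ⟩, ?_⟩
      have := hgf (W ⊓ Z) inf_le_right (res _ (inf_le_left.trans hW) v) _ le_rfl
        (res _ inf_le_left b)
      rw [res_twistApp, res_homApp, res_twistApp]
      refine Eq.trans ?_ this
      change _ = twistApp (homApp (endZeroHom f) _ (res _ (inf_le_left.trans hW) v)) le_rfl _
      rw [← res_homApp (endZeroHom f) hV]
      rfl)
    (fun U g h ↦ endZeroHom_injective (IsTwistOf.eq_zero_left hgen h))
    (fun U f h ↦ endZeroHom_injective (IsTwistOf.eq_zero_right h))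
    -- Post-composition with `g` works over all of `U`. The opposite direction conjugates by
    -- evaluation at a generator and is therefore only local.
    (fun U g p hp ↦ by
      obtain ⟨f, hf⟩ := exists_isTwistOf_right (x := x) (endZeroHom g)
      refine ⟨U, le_rfl, hp, endZeroMk f ((hf.isTrace_iff hM hgen).2 (isTrace_endZeroHom g)), ?_⟩
      rw [res_self]
      exact hf)
    (fun U f p hp ↦ by
      obtain ⟨V, t, hpV, ht⟩ := hgen p
      obtain ⟨g, hg⟩ := (ht.restrict (inf_le_right : U ⊓ V ≤ V)).exists_isTwistOf_left
        (endZeroHom (res _ inf_le_left f))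
      exact ⟨U ⊓ V, inf_le_left, ⟨hp, hpV⟩,
        endZeroMk g ((hg.isTrace_iff hM hgen).1 (isTrace_endZeroHom _)), hg⟩)
  exact ⟨θ, fun U s t ↦ IsTrace.trace_eq (hM.twist hgen)
    (((hθ U s).comp (hθ U t)).isTrace_iff hM hgen |>.2 (isTrace_trace hM _))⟩

end Generator

/-- If `A : M → M` and `B : N → N` are intertwined up to the scalar `h` by the injection `i` of a
lattice spanned by `b₀, t b₁` then `tr A = h tr B`. -/
theorem linearMap_trace_eq_of_lattice {R M N : Type*} [CommRing R] [AddCommGroup M] [Module R M]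
    [AddCommGroup N] [Module R N] (b : Module.Basis (Fin 2) R M) (b' : Module.Basis (Fin 2) R N)
    {t h : R} (ht : ∀ a, t * a = 0 → a = 0) (i : N →ₗ[R] M) (h0 : i (b' 0) = b 0)
    (h1 : i (b' 1) = t • b 1) (A : Module.End R M) (B : Module.End R N)
    (hAB : ∀ n, A (i n) = h • i (B n)) :
    LinearMap.trace R M A = h * LinearMap.trace R N B := by
  have hB : ∀ n, i n = b'.repr n 0 • b 0 + (t * b'.repr n 1) • b 1 := fun n ↦ by
    conv_lhs => rw [← b'.sum_repr n]
    rw [Fin.sum_univ_two, map_add, map_smul, map_smul, h0, h1, smul_smul, mul_comm t]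
  have e0 := congrArg (fun m ↦ b.repr m 0) (hAB (b' 0))
  have e1 := congrArg (fun m ↦ b.repr m 1) (hAB (b' 1))
  rw [h0, hB] at e0
  rw [h1, hB] at e1
  simp only [map_smul, map_add, Finsupp.smul_apply, Finsupp.add_apply, Module.Basis.repr_self,
    smul_eq_mul] at e0 e1
  simp at e0 e1
  -- Only the second diagonal entry picks up the factor `t`, and it does so on both sides, so
  -- regularity of `t` removes it.
  have e1' : b.repr (A (b 1)) 1 = h * b'.repr (B (b' 1)) 1 := sub_eq_zero.1 (ht _ (by
    rw [mul_sub, e1]; ring))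
  rw [LinearMap.trace_eq_matrix_trace R b, LinearMap.trace_eq_matrix_trace R b']
  simp [Matrix.trace, LinearMap.toMatrix_apply, e0, e1', mul_add]

/-! ### The Hecke transform of `End₀(F)` and `End₀(F')` in a local model -/

section Model

variable {X : Scheme.{u}} {F : X.Modules} {U V W : X.Opens} {x : X}

/-- The entries of the matrix of an endomorphism with respect to a frame. -/
noncomputable def IsFrame.entry {e : Fin 2 → Γ(F, V)} (he : IsFrame F e) (hW : W ≤ V)
    (f : Γ(endZero F, W)) (i j : Fin 2) : Γ(X, W) :=
  (he.basis hW).repr (homApp (endZeroHom f) le_rfl (he.basis hW j)) i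

/-- A local description of the elementary transforms of `F` and `End₀(F)` given by `D` and `L`: in
the frame `e` the sections of the former are the vectors `(α, tβ)`, those of the latter are the
matrices with entries in `(t)` on the diagonal and with lower left entry in `(t²)`. -/
structure IsModel (D : Submodule (X.presheaf.stalk x) (ThickFiber F x 1))
    (L : Submodule (X.presheaf.stalk x) (ThickFiber (endZero F) x 2))
    (t : Γ(X, V)) (e : Fin 2 → Γ(F, V)) : Prop where
  gen : IsLocalGenerator x t
  frame : IsFrame F e
  mem_D : ∀ (W : X.Opens) (h : W ≤ V) (v : Γ(F, W)), (∀ hx : x ∈ W, jet F 1 hx v ∈ D) ↔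
    resO h t ∣ (frame.basis h).repr v 1
  mem_L : ∀ (W : X.Opens) (h : W ≤ V) (f : Γ(endZero F, W)),
    (∀ hx : x ∈ W, jet (endZero F) 2 hx f ∈ L) ↔
      resO h t ∣ frame.entry h f 0 0 ∧ resO h t ^ 2 ∣ frame.entry h f 1 0

variable {D : Submodule (X.presheaf.stalk x) (ThickFiber F x 1)}
  {L : Submodule (X.presheaf.stalk x) (ThickFiber (endZero F) x 2)}
  {t : Γ(X, V)} {e : Fin 2 → Γ(F, V)}

theorem IsFrame.entry_res (he : IsFrame F e) (hU : U ≤ V) (hW : W ≤ U) (f : Γ(endZero F, U))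
    (i j : Fin 2) :
    he.entry (hW.trans hU) (res _ hW f) i j = resO hW (he.entry hU f i j) := by
  have : he.basis (hW.trans hU) j = res F hW (he.basis hU j) := by
    rw [he.basis_apply, he.basis_apply, res_res]
  rw [entry, entry, this, ← he.repr_res hU hW, res_homApp]
  rfl

theorem IsFrame.basis_restrict {n : ℕ} {s : Fin n → Γ(F, V)} (hs : IsFrame F s) (hU : U ≤ V)
    (hW : W ≤ U) : (hs.restrict hU).basis hW = hs.basis (hW.trans hU) :=
  Module.Basis.eq_of_apply_eq fun i ↦ by
    rw [IsFrame.basis_apply, IsFrame.basis_apply, res_res]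

theorem IsModel.restrict (h : IsModel D L t e) (hU : U ≤ V) :
    IsModel D L (resO hU t) (fun i ↦ res F hU (e i)) where
  gen := h.gen.restrict hU
  frame := h.frame.restrict hU
  mem_D W hW v := by
    rw [resO_resO, IsFrame.basis_restrict]; exact h.mem_D W (hW.trans hU) v
  mem_L W hW f := by
    rw [resO_resO, IsFrame.entry, IsFrame.entry, IsFrame.basis_restrict]
    exact h.mem_L W (hW.trans hU) f

/-- The inclusion of an elementary transform, as a linear map on sections. -/
noncomputable def elementaryLinearIncl (M : X.Modules) (x : X) (n : ℕ)
    (L : Submodule (X.presheaf.stalk x) (ThickFiber M x n)) (U : X.Opens) :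
    Γ(elementary M x n L, U) →ₗ[Γ(X, U)] Γ(M, U) where
  toFun := elementaryIncl
  map_add' _ _ := rfl
  map_smul' _ _ := rfl

/-- The sections `e₀`, `t e₁` of `F'`. -/
noncomputable def IsModel.latticeFrame (h : IsModel D L t e) :
    Fin 2 → Γ(elementary F x 1 D, V) :=
  ![elementaryMk (e 0) ((h.mem_D V le_rfl _).2 (by
      have := h.frame.basis_apply le_rfl 0
      rw [res_self] at this
      rw [← this]; simp)),
    elementaryMk (t • e 1) ((h.mem_D V le_rfl _).2 (by
      have := h.frame.basis_apply le_rfl 1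
      rw [res_self] at this
      rw [← this, resO_self]; simp))]

theorem IsModel.incl_latticeFrame_zero (h : IsModel D L t e) (hW : W ≤ V) :
    elementaryIncl (res _ hW (h.latticeFrame 0)) = h.frame.basis hW 0 :=
  (h.frame.basis_apply hW 0).symm

theorem IsModel.incl_latticeFrame_one (h : IsModel D L t e) (hW : W ≤ V) :
    elementaryIncl (res _ hW (h.latticeFrame 1)) = resO hW t • h.frame.basis hW 1 := by
  rw [h.frame.basis_apply hW 1, ← res_smul]
  rfl

/-- Independence uses that `t` is regular; spanning holds because the second coordinate of a section
of `F'` is divisible by `t`. -/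
theorem IsModel.isFrame_latticeFrame (h : IsModel D L t e) :
    IsFrame (elementary F x 1 D) h.latticeFrame := fun W hW ↦ by
  have key : ∀ c : Fin 2 → Γ(X, W), elementaryIncl (∑ i, c i • res _ hW (h.latticeFrame i)) =
      c 0 • h.frame.basis hW 0 + (resO hW t * c 1) • h.frame.basis hW 1 := fun c ↦ by
    rw [Fin.sum_univ_two, elementaryIncl_add, elementaryIncl_smul, elementaryIncl_smul,
      h.incl_latticeFrame_zero, h.incl_latticeFrame_one, smul_smul, mul_comm (c 1)]
  constructor
  · rw [Fintype.linearIndependent_iff]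
    intro c hc
    have h1 := key c
    rw [hc, elementaryIncl_zero] at h1
    have h2 := congrArg (h.frame.basis hW).repr h1
    have h3 := DFunLike.congr_fun h2 0
    have h4 := DFunLike.congr_fun h2 1
    simp at h3 h4
    intro i
    fin_cases i
    · exact h3.symm
    · exact h.gen.regular W hW _ h4.symm
  · refine eq_top_iff.2 fun v _ ↦ ?_
    obtain ⟨β, hβ⟩ := (h.mem_D W hW (elementaryIncl v)).1 fun hx ↦ jet_elementaryIncl v hx
    have : v = ∑ i, (![(h.frame.basis hW).repr (elementaryIncl v) 0, β] : Fin 2 → Γ(X, W)) i •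
        res _ hW (h.latticeFrame i) := by
      apply elementaryIncl_injective
      rw [key]
      conv_lhs => rw [← (h.frame.basis hW).sum_repr (elementaryIncl v)]
      rw [Fin.sum_univ_two, hβ]
      rfl
    rw [this]
    exact Submodule.sum_mem _ fun i _ ↦ Submodule.smul_mem _ _ (Submodule.subset_span ⟨i, rfl⟩)

/-- The endomorphisms `A` of `F` and `B` of `F'` agree on `F'` up to the factor `a`. -/
def Intertwines (a : Γ(X, U)) (A : Γ(homSheaf F F, U))
    (B : Γ(homSheaf (elementary F x 1 D) (elementary F x 1 D), U)) : Prop :=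
  ∀ (V : X.Opens) (hV : V ≤ U) (v : Γ(elementary F x 1 D, V)),
    homApp A hV (elementaryIncl v) = resO hV a • elementaryIncl (homApp B hV v)

theorem Intertwines.comp {a a' : Γ(X, U)} {A A' : Γ(homSheaf F F, U)}
    {B B' : Γ(homSheaf (elementary F x 1 D) (elementary F x 1 D), U)}
    (h : Intertwines a A B) (h' : Intertwines a' A' B') :
    Intertwines (a * a') (homComp A A') (homComp B B') := fun V hV v ↦ by
  rw [homApp_homComp, homApp_homComp, LinearMap.comp_apply, LinearMap.comp_apply, h', map_smul, h,
    smul_smul, map_mul, mul_comm]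

theorem Intertwines.res {a : Γ(X, U)} {A : Γ(homSheaf F F, U)}
    {B : Γ(homSheaf (elementary F x 1 D) (elementary F x 1 D), U)}
    (h : Intertwines a A B) (hV : V ≤ U) :
    Intertwines (resO hV a) (OrthogonalHecke.res _ hV A) (OrthogonalHecke.res _ hV B) :=
  fun W hW v ↦ by
    rw [homApp_res, homApp_res, resO_resO]
    exact h W (hW.trans hV) v

theorem IsModel.linearMap_trace (h : IsModel D L t e) (hV : V ≤ U) {a : Γ(X, U)}
    {A : Γ(homSheaf F F, U)} {B : Γ(homSheaf (elementary F x 1 D) (elementary F x 1 D), U)}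
    (hAB : Intertwines a A B) :
    LinearMap.trace Γ(X, V) Γ(F, V) (homApp A hV) =
      resO hV a * LinearMap.trace Γ(X, V) Γ(elementary F x 1 D, V) (homApp B hV) := by
  refine linearMap_trace_eq_of_lattice (h.frame.basis le_rfl)
    (h.isFrame_latticeFrame.basis le_rfl) (t := resO le_rfl t) (h.gen.regular V le_rfl)
    (elementaryLinearIncl F x 1 D V) ?_ ?_ _ _ (hAB V hV)
  · rw [IsFrame.basis_apply]
    exact h.incl_latticeFrame_zero le_rfl
  · rw [IsFrame.basis_apply]
    exact h.incl_latticeFrame_one le_rfl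

theorem isVectorBundle_elementary
    (hmod : ∀ p : X, ∃ (V : X.Opens) (t : Γ(X, V)) (e : Fin 2 → Γ(F, V)),
      p ∈ V ∧ IsModel D L t e) :
    IsVectorBundle (elementary F x 1 D) 2 := fun p ↦ by
  obtain ⟨V, t, e, hp, h⟩ := hmod p
  exact ⟨V, _, hp, h.isFrame_latticeFrame⟩

theorem exists_isModel_le
    (hmod : ∀ p : X, ∃ (V : X.Opens) (t : Γ(X, V)) (e : Fin 2 → Γ(F, V)),
      p ∈ V ∧ IsModel D L t e)
    {p : X} (hp : p ∈ U) :
    ∃ (V : X.Opens) (_ : V ≤ U) (t : Γ(X, V)) (e : Fin 2 → Γ(F, V)), p ∈ V ∧ IsModel D L t e := by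
  obtain ⟨V, t, e, hpV, h⟩ := hmod p
  exact ⟨U ⊓ V, inf_le_left, _, _, ⟨hp, hpV⟩, h.restrict inf_le_right⟩

/-- Since `F'` and `F` coincide after inverting `t`, `A` and `aB` are the same rational
endomorphism. This yields both the vanishing of traces and the comparison of the trace forms. -/
theorem Intertwines.isTrace_left
    (hmod : ∀ p : X, ∃ (V : X.Opens) (t : Γ(X, V)) (e : Fin 2 → Γ(F, V)),
      p ∈ V ∧ IsModel D L t e)
    (hF : IsVectorBundle F 2) {a : Γ(X, U)} {A : Γ(homSheaf F F, U)}
    {B : Γ(homSheaf (elementary F x 1 D) (elementary F x 1 D), U)} (hAB : Intertwines a A B)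
    {c : Γ(X, U)} (hB : IsTrace B c) : IsTrace A (a * c) := by
  refine .of_locally hF fun p hp ↦ ?_
  obtain ⟨V, hV, t, e, hpV, h⟩ := exists_isModel_le hmod hp
  exact ⟨V, hV, hpV, 2, e, h.frame, by
    rw [h.linearMap_trace hV hAB, map_mul, hB V hV 2 _ h.isFrame_latticeFrame]⟩

/-- Here `tr A = t tr B`, and `t` is regular. -/
theorem IsModel.isTrace_right (h : IsModel D L t e)
    (hmod : ∀ p : X, ∃ (V : X.Opens) (t : Γ(X, V)) (e : Fin 2 → Γ(F, V)),
      p ∈ V ∧ IsModel D L t e) {A : Γ(homSheaf F F, V)}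
    {B : Γ(homSheaf (elementary F x 1 D) (elementary F x 1 D), V)} (hAB : Intertwines t A B)
    (hA : IsTrace A 0) : IsTrace B 0 := by
  refine .of_locally (isVectorBundle_elementary hmod) fun p hp ↦ ?_
  refine ⟨V, le_rfl, hp, 2, _, h.isFrame_latticeFrame, ?_⟩
  have h1 := h.linearMap_trace le_rfl hAB
  rw [← hA V le_rfl 2 e h.frame, map_zero] at h1
  rw [map_zero]
  exact (h.gen.regular V le_rfl _ h1.symm).symm

theorem IsModel.eq_zero_of_smul (h : IsModel D L t e) (hW : W ≤ V) {m : Γ(F, W)}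
    (hm : resO hW t • m = 0) : m = 0 := by
  apply (h.frame.basis hW).repr.injective
  ext i
  refine (h.gen.regular W hW _ ?_).trans (by simp)
  rw [← smul_eq_mul, ← Finsupp.smul_apply, ← map_smul, hm]
  simp

theorem IsFrame.entry_add_entry {e : Fin 2 → Γ(F, V)} (he : IsFrame F e) (hW : W ≤ V)
    (f : Γ(endZero F, W)) : he.entry hW f 1 1 = - he.entry hW f 0 0 := by
  have := isTrace_endZeroHom f W le_rfl 2 _ (he.restrict hW)
  rw [map_zero, LinearMap.trace_eq_matrix_trace _ (he.basis hW), Matrix.trace,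
    Fin.sum_univ_two] at this
  simp only [Matrix.diag_apply, LinearMap.toMatrix_apply] at this
  exact eq_neg_of_add_eq_zero_right this.symm

theorem IsFrame.homApp_eq {e : Fin 2 → Γ(F, V)} (he : IsFrame F e) (hW : W ≤ V)
    (f : Γ(endZero F, W)) (v : Γ(F, W)) : homApp (endZeroHom f) le_rfl v =
      ((he.basis hW).repr v 0 * he.entry hW f 0 0 + (he.basis hW).repr v 1 * he.entry hW f 0 1) •
          he.basis hW 0 +
        ((he.basis hW).repr v 0 * he.entry hW f 1 0 - (he.basis hW).repr v 1 *
          he.entry hW f 0 0) • he.basis hW 1 := by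
  have hj : ∀ j, homApp (endZeroHom f) le_rfl (he.basis hW j) =
      he.entry hW f 0 j • he.basis hW 0 + he.entry hW f 1 j • he.basis hW 1 := fun j ↦ by
    conv_lhs => rw [← (he.basis hW).sum_repr (homApp (endZeroHom f) le_rfl (he.basis hW j))]
    rw [Fin.sum_univ_two]
    rfl
  conv_lhs => rw [← (he.basis hW).sum_repr v, Fin.sum_univ_two]
  rw [map_add, map_smul, map_smul, hj, hj, he.entry_add_entry]
  module

/-- This is the inclusion of `t⁻¹E'` in `End(F')`: a matrix with diagonal in `(t)` and lower left
entry in `(t²)` maps `F'` into `tF'`. -/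
theorem IsModel.exists_smul_eq (h : IsModel D L t e) (hW : W ≤ V) (f : Γ(endZero F, W))
    (hf : ∀ hx : x ∈ W, jet (endZero F) 2 hx f ∈ L) (v : Γ(elementary F x 1 D, W)) :
    ∃ w : Γ(elementary F x 1 D, W),
      homApp (endZeroHom f) le_rfl (elementaryIncl v) = resO hW t • elementaryIncl w := by
  obtain ⟨⟨y, hy⟩, z, hz⟩ := (h.mem_L W hW f).1 hf
  obtain ⟨β, hβ⟩ := (h.mem_D W hW (elementaryIncl v)).1 fun hx ↦ jet_elementaryIncl v hx
  set α := (h.frame.basis hW).repr (elementaryIncl v) 0 with hα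
  -- Applying `(ty, b; t²z, -ty)` to `α e₀ + tβ e₁` gives `t` times `(αy + βb) e₀ + (αz - βy) t e₁`.
  refine ⟨(α * y + β * h.frame.entry hW f 0 1) • res _ hW (h.latticeFrame 0) +
    (α * z - β * y) • res _ hW (h.latticeFrame 1), ?_⟩
  rw [elementaryIncl_add, elementaryIncl_smul, elementaryIncl_smul, h.incl_latticeFrame_zero,
    h.incl_latticeFrame_one, h.frame.homApp_eq hW, ← hα, hβ, hy, hz]
  module

/-- This gives `𝒪(-x)F ⊆ F'`, which lets endomorphisms of `F'` act on multiples of arbitrary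
sections of `F`. -/
theorem smul_mem_of_mem_ideal (D : Submodule (X.presheaf.stalk x) (ThickFiber F x 1)) {a : Γ(X, U)}
    (ha : ∀ hx : x ∈ U, germO hx a ∈ maxIdeal x) (u : Γ(F, U)) (hx : x ∈ U) :
    jet F 1 hx (a • u) ∈ D := by
  have : jet F 1 hx (a • u) = 0 := by
    rw [jet, germ_smul, Submodule.Quotient.mk_eq_zero, pow_one]
    exact Submodule.smul_mem_smul (ha hx) trivial
  rw [this]
  exact D.zero_mem

theorem germO_res_idealIncl (a : Γ(idealSheaf x, U)) (hV : V ≤ U) (hx : x ∈ V) :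
    germO hx (resO hV (idealIncl a)) ∈ maxIdeal x := by
  rw [germO_res hV]; exact germO_idealIncl a _

theorem jet_res (M : X.Modules) (n : ℕ) (hV : V ≤ U) (hx : x ∈ V) (s : Γ(M, U)) :
    jet M n hx (res M hV s) = jet M n (hV hx) s := by
  rw [jet, germ_res, jet]

/-- An endomorphism `B` of `F'` and a function `a` vanishing at `x` define the endomorphism
`u ↦ B(a u)` of `F`. -/
noncomputable def extendHom (B : Γ(homSheaf (elementary F x 1 D) (elementary F x 1 D), U))
    (a : Γ(idealSheaf x, U)) : Γ(homSheaf F F, U) :=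
  homMk (fun V hV ↦ elementaryLinearIncl F x 1 D V ∘ₗ homApp B hV ∘ₗ
    { toFun := fun u ↦ elementaryMk (resO hV (idealIncl a) • u)
        (smul_mem_of_mem_ideal D (germO_res_idealIncl a hV) u)
      map_add' := fun u u' ↦ elementaryIncl_injective (smul_add _ _ _)
      map_smul' := fun c u ↦ elementaryIncl_injective (smul_comm _ _ _) })
    fun W V hW hV u ↦ by
      change elementaryIncl (res _ hW (homApp B hV _)) = elementaryIncl (homApp B (hW.trans hV) _)
      rw [res_homApp]
      refine congrArg (fun w ↦ elementaryIncl (homApp B (hW.trans hV) w))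
        (elementaryIncl_injective ?_)
      exact (res_smul F hW _ u).trans (by rw [resO_resO]; rfl)

theorem intertwines_extendHom (B : Γ(homSheaf (elementary F x 1 D) (elementary F x 1 D), U))
    (a : Γ(idealSheaf x, U)) : Intertwines (idealIncl a) (extendHom B a) B := fun V hV v ↦ by
  rw [← elementaryIncl_smul, ← map_smul]
  rfl

/-- The endomorphism of `F` is determined by the one of `F'`. -/
theorem Intertwines.eq_left
    (hmod : ∀ p : X, ∃ (V : X.Opens) (t : Γ(X, V)) (e : Fin 2 → Γ(F, V)),
      p ∈ V ∧ IsModel D L t e) {a : Γ(X, U)} {A A' : Γ(homSheaf F F, U)}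
    {B : Γ(homSheaf (elementary F x 1 D) (elementary F x 1 D), U)} (h : Intertwines a A B)
    (h' : Intertwines a A' B) : A = A' := by
  refine homSheaf_ext fun V hV u ↦ section_ext _ _ _ fun p hp ↦ ?_
  obtain ⟨W, hW, t, e, hpW, hm⟩ := exists_isModel_le hmod hp
  refine ⟨W, hW, hpW, sub_eq_zero.1 (hm.eq_zero_of_smul le_rfl ?_)⟩
  rw [res_homApp, res_homApp, smul_sub, sub_eq_zero, resO_self, ← (homApp A _).map_smul,
    ← (homApp A' _).map_smul]
  -- The section `t u` lies in `F'`, where `A` and `A'` agree; the factor `t` can then be cancelled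
  -- in `F`.
  have hv := smul_mem_of_mem_ideal D (a := t) (fun hx ↦ (hm.gen.mem_iff W le_rfl t).2
    (by rw [resO_self]) hx) (OrthogonalHecke.res F hW u)
  exact (h W (hW.trans hV) (elementaryMk _ hv)).trans (h' W (hW.trans hV) (elementaryMk _ hv)).symm

/-- The value of a section of `H(End₀(F), L)` at a section of `𝒪(-x)`, as an endomorphism. -/
noncomputable def heckeHom (s : Γ(hecke (endZero F) x L, U)) (hV : V ≤ U)
    (a : Γ(idealSheaf x, V)) : Γ(homSheaf F F, V) :=
  endZeroHom (elementaryIncl (twistApp (M := elementary (endZero F) x 2 L) s hV a))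

theorem heckeHom_res (s : Γ(hecke (endZero F) x L, U)) (hV : V ≤ U) (hW : W ≤ V)
    (a : Γ(idealSheaf x, W)) : heckeHom (res _ hV s) hW a = heckeHom s (hW.trans hV) a := rfl

theorem res_heckeHom (s : Γ(hecke (endZero F) x L, U)) (hV : V ≤ U) (hW : W ≤ V)
    (a : Γ(idealSheaf x, V)) :
    res _ hW (heckeHom s hV a) = heckeHom s (hW.trans hV) (res _ hW a) :=
  congrArg (fun w ↦ endZeroHom (elementaryIncl w))
    (res_twistApp (M := elementary (endZero F) x 2 L) s hV hW a)

theorem heckeHom_smul (s : Γ(hecke (endZero F) x L, U)) (hV : V ≤ U) (c : Γ(X, V))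
    (a : Γ(idealSheaf x, V)) : heckeHom s hV (c • a) = c • heckeHom s hV a := by
  rw [heckeHom, map_smul]
  rfl

/-- Corresponding sections of `H(End₀(F), L)` and `End₀(F')`. -/
def HeckeRel (s : Γ(hecke (endZero F) x L, U)) (f : Γ(endZero (elementary F x 1 D), U)) : Prop :=
  ∀ (V : X.Opens) (hV : V ≤ U) (a : Γ(idealSheaf x, V)),
    Intertwines (idealIncl a) (heckeHom s hV a) (res _ hV (endZeroHom f))

/-- The partner of `s` is `t⁻¹ s(t)`, which preserves `F'` by `IsModel.exists_smul_eq`. -/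
theorem IsModel.exists_heckeRel_right (h : IsModel D L t e)
    (hmod : ∀ p : X, ∃ (V : X.Opens) (t : Γ(X, V)) (e : Fin 2 → Γ(F, V)),
      p ∈ V ∧ IsModel D L t e) (s : Γ(hecke (endZero F) x L, V)) :
    ∃ f : Γ(endZero (elementary F x 1 D), V), HeckeRel s f := by
  have hex : ∀ (W : X.Opens) (hW : W ≤ V) (v : Γ(elementary F x 1 D, W)),
      ∃ w : Γ(elementary F x 1 D, W), homApp
        (heckeHom s le_rfl (h.gen.section le_rfl)) hW (elementaryIncl v) = resO hW t • elementaryIncl w := fun W hW v ↦ by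
    have := h.exists_smul_eq hW (elementaryIncl
        (twistApp (M := elementary (endZero F) x 2 L) s hW (h.gen.section hW)))
        (fun hx ↦ jet_elementaryIncl _ hx) v
    change ∃ w, homApp (heckeHom s hW (h.gen.section hW)) le_rfl _ = _ at this
    rw [← h.gen.res_section le_rfl hW, ← res_heckeHom s le_rfl hW] at this
    exact this
  choose w hw using hex
  have huniq : ∀ (W : X.Opens) (hW : W ≤ V) (v v' : Γ(elementary F x 1 D, W)),
      resO hW t • elementaryIncl v = resO hW t • elementaryIncl v' → v = v' :=
    fun W hW v v' hv ↦ elementaryIncl_injective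
      (sub_eq_zero.1 (h.eq_zero_of_smul hW (by rw [smul_sub, hv, sub_self])))
  let B : Γ(homSheaf (elementary F x 1 D) (elementary F x 1 D), V) :=
    homMk (fun W hW ↦
      { toFun := w W hW
        map_add' := fun v v' ↦ huniq W hW _ _ (by
          rw [← hw, elementaryIncl_add, map_add, hw, hw, ← smul_add, elementaryIncl_add])
        map_smul' := fun c v ↦ huniq W hW _ _ (by
          rw [← hw, elementaryIncl_smul, map_smul, hw, RingHom.id_apply, elementaryIncl_smul,
            smul_comm]) })
      fun W' W hW' hW v ↦ huniq W' _ _ _ (by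
        change _ = resO _ t • elementaryIncl (w W' (hW'.trans hW) (res _ hW' v))
        rw [← hw, elementaryIncl_res, elementaryIncl_res, ← resO_resO hW' hW, ← res_smul,
          ← res_homApp _ hW hW']
        exact congrArg _ (hw W hW v).symm)
  have hB : Intertwines t (heckeHom s le_rfl (h.gen.section le_rfl)) B := fun W hW v ↦ hw W hW v
  refine ⟨endZeroMk B (h.isTrace_right hmod hB (isTrace_endZeroHom _)), fun W hW a ↦ ?_⟩
  -- The relation holds at the generator `t` by construction, and linearity extends it to every
  -- multiple `c t`.
  obtain ⟨c, rfl⟩ := h.gen.exists_eq_smul hW a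
  rw [heckeHom_smul, idealIncl_smul, ← h.gen.res_section le_rfl hW, ← res_heckeHom s le_rfl hW]
  intro W' hW' v
  have := hB.res hW W' hW' v
  rw [homApp_smul, LinearMap.smul_apply, map_mul, mul_smul, idealIncl_res,
    h.gen.idealIncl_section, resO_self]
  exact congrArg _ this

/-- The partner of `f` sends `a` to the endomorphism `u ↦ f(a u)` of `F`. This formula needs no
choice of frame, so it is global on `U`; the local model only serves to check that its values are
trace-free and lie in `E'`. -/
theorem exists_heckeRel_left
    (hmod : ∀ p : X, ∃ (V : X.Opens) (t : Γ(X, V)) (e : Fin 2 → Γ(F, V)),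
      p ∈ V ∧ IsModel D L t e) (hF : IsVectorBundle F 2)
    (f : Γ(endZero (elementary F x 1 D), U)) :
    ∃ s : Γ(hecke (endZero F) x L, U), HeckeRel s f := by
  have htr : ∀ (V : X.Opens) (hV : V ≤ U) (a : Γ(idealSheaf x, V)),
      IsTrace (extendHom (res _ hV (endZeroHom f)) a) 0 := fun V hV a ↦ by
    have := (intertwines_extendHom (res _ hV (endZeroHom f)) a).isTrace_left hmod hF
      (isTrace_endZeroHom (res _ hV f))
    rwa [mul_zero] at this
  have hL : ∀ (V : X.Opens) (hV : V ≤ U) (a : Γ(idealSheaf x, V)) (hx : x ∈ V),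
      jet (endZero F) 2 hx (endZeroMk _ (htr V hV a)) ∈ L := fun V hV a hx ↦ by
    obtain ⟨W, hW, t, e, hxW, h⟩ := exists_isModel_le hmod hx
    rw [← jet_res _ _ hW hxW]
    refine (h.mem_L W le_rfl _).2 ?_ hxW
    obtain ⟨c, hc⟩ := (h.gen.mem_iff W le_rfl (resO hW (idealIncl a))).1
      (germO_res_idealIncl a hW)
    -- Both conditions defining `L` concern the first column. As `e₀` lies in `F'`, this column is
    -- `a f(e₀)`, with `a` divisible by `t`; the second coordinate of `f(e₀)`, a section of `F'`,
    -- supplies another factor `t`.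
    set w := homApp (endZeroHom f) (hW.trans hV) (h.latticeFrame 0) with hw
    obtain ⟨β, hβ⟩ := (h.mem_D W le_rfl (elementaryIncl w)).1 fun hx ↦ jet_elementaryIncl w hx
    have key : homApp (extendHom (res _ hV (endZeroHom f)) a) hW (h.frame.basis le_rfl 0) =
        (resO le_rfl t * c) • elementaryIncl w := by
      rw [← h.incl_latticeFrame_zero le_rfl, intertwines_extendHom, hc, res_self]
      rfl
    have hent : ∀ i, h.frame.entry le_rfl (res _ hW (endZeroMk _ (htr V hV a))) i 0 =
        (resO le_rfl t * c) * (h.frame.basis le_rfl).repr (elementaryIncl w) i := fun i ↦ by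
      have := congrArg (fun m ↦ (h.frame.basis le_rfl).repr m i) key
      simp only [map_smul, Finsupp.smul_apply, smul_eq_mul] at this
      exact this
    rw [hent, hent, hβ]
    exact ⟨⟨c * _, mul_assoc _ _ _⟩, ⟨c * β, by ring⟩⟩
  refine ⟨homMk (M := idealSheaf x) (N := elementary (endZero F) x 2 L) (fun V hV ↦
    { toFun := fun a ↦ elementaryMk (endZeroMk _ (htr V hV a)) (hL V hV a)
      map_add' := fun a b ↦ ?_
      map_smul' := fun c a ↦ ?_ }) ?_, fun V hV a ↦ intertwines_extendHom _ a⟩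
  · apply elementaryIncl_injective
    apply endZeroHom_injective
    -- Linearity in `a`, like compatibility with restriction, follows because an endomorphism of `F`
    -- is determined by its effect on `F'`.
    refine (intertwines_extendHom _ (a + b)).eq_left hmod fun W hW v ↦ ?_
    have h1 := intertwines_extendHom (res _ hV (endZeroHom f)) a W hW v
    have h2 := intertwines_extendHom (res _ hV (endZeroHom f)) b W hW v
    rw [idealIncl_add, map_add, add_smul, ← h1, ← h2]
    rfl
  · apply elementaryIncl_injective
    apply endZeroHom_injective
    refine (intertwines_extendHom _ (c • a)).eq_left hmod fun W hW v ↦ ?_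
    have h1 := intertwines_extendHom (res _ hV (endZeroHom f)) a W hW v
    rw [idealIncl_smul, map_mul, mul_smul, ← h1]
    rfl
  · intro W V hW hV a
    apply elementaryIncl_injective
    apply endZeroHom_injective
    exact ((intertwines_extendHom (res _ hV (endZeroHom f)) a).res hW).eq_left hmod
      (intertwines_extendHom (res _ (hW.trans hV) (endZeroHom f)) (res _ hW a))

theorem HeckeRel.eq_zero_left
    (hmod : ∀ p : X, ∃ (V : X.Opens) (t : Γ(X, V)) (e : Fin 2 → Γ(F, V)),
      p ∈ V ∧ IsModel D L t e) {s : Γ(hecke (endZero F) x L, U)}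
    (h : HeckeRel (D := D) s 0) : s = 0 :=
  twist_ext (M := elementary (endZero F) x 2 L) fun V hV a ↦
    elementaryIncl_injective (endZeroHom_injective ((h V hV a).eq_left hmod fun _ _ _ ↦
      (smul_zero _).symm))

theorem HeckeRel.eq_zero_right
    (hmod : ∀ p : X, ∃ (V : X.Opens) (t : Γ(X, V)) (e : Fin 2 → Γ(F, V)),
      p ∈ V ∧ IsModel D L t e) {f : Γ(endZero (elementary F x 1 D), U)}
    (h : HeckeRel (L := L) 0 f) : f = 0 := by
  refine endZeroHom_injective (homSheaf_ext fun V hV v ↦ section_ext _ _ _ fun p hp ↦ ?_)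
  obtain ⟨W, hW, t, e, hpW, hm⟩ := exists_isModel_le hmod hp
  refine ⟨W, hW, hpW, ?_⟩
  rw [res_homApp, res_homApp]
  refine elementaryIncl_injective (hm.eq_zero_of_smul le_rfl ?_)
  have := h W (hW.trans hV) (hm.gen.section le_rfl) W le_rfl (res _ hW v)
  rw [hm.gen.idealIncl_section, resO_resO] at this
  exact this.symm

/-- Composing the two relations gives `tr(s(a) s'(b)) = a b tr(f f')`, which is the equation
characterizing the induced form. -/
theorem heckeForm_eq_of_heckeRel
    (hmod : ∀ p : X, ∃ (V : X.Opens) (t : Γ(X, V)) (e : Fin 2 → Γ(F, V)),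
      p ∈ V ∧ IsModel D L t e) (hF : IsVectorBundle F 2) {s s' : Γ(hecke (endZero F) x L, U)}
    {f f' : Γ(endZero (elementary F x 1 D), U)} (h : HeckeRel s f) (h' : HeckeRel s' f') :
    traceForm (elementary F x 1 D) U f f' = heckeForm (traceForm F) x L U s s' := by
  have hc : ∀ (V : X.Opens) (hV : V ≤ U) (a b : Γ(idealSheaf x, V)),
      traceForm F V (elementaryIncl (twistApp (M := elementary (endZero F) x 2 L) s hV a))
        (elementaryIncl (twistApp (M := elementary (endZero F) x 2 L) s' hV b)) =
        idealIncl a * idealIncl b * resO hV (traceForm (elementary F x 1 D) U f f') :=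
    fun V hV a b ↦ IsTrace.trace_eq hF (((h V hV a).comp (h' V hV b)).isTrace_left hmod hF
      ((isTrace_trace (isVectorBundle_elementary hmod) _).res hV))
  have hex : ∃ c : Γ(X, U), ∀ (V : X.Opens) (hV : V ≤ U) (a b : Γ(idealSheaf x, V)),
      traceForm F V (elementaryIncl (twistApp (M := elementary (endZero F) x 2 L) s hV a))
        (elementaryIncl (twistApp (M := elementary (endZero F) x 2 L) s' hV b)) =
        idealIncl a * idealIncl b * resO hV c := ⟨_, hc⟩
  have hform : heckeForm (traceForm F) x L U s s' = hex.choose := dif_pos hex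
  rw [hform]
  refine function_ext _ _ fun p hp ↦ ?_
  obtain ⟨V, hV, t, e, hpV, hm⟩ := exists_isModel_le hmod hp
  refine ⟨V, hV, hpV, ?_⟩
  -- Evaluation at `(t, t)` shows that the solution of this equation is unique: `t²` is cancelled
  -- one factor at a time.
  have := (hc V hV (hm.gen.section le_rfl) (hm.gen.section le_rfl)).symm.trans
    (hex.choose_spec V hV (hm.gen.section le_rfl) (hm.gen.section le_rfl))
  rw [hm.gen.idealIncl_section, mul_assoc, mul_assoc] at this
  exact hm.gen.cancel le_rfl (hm.gen.cancel le_rfl this)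

/-- The Hecke transform of `End₀(F)` is isometric to `End₀(F')`. -/
theorem isometricTo_endZero_elementary
    (hmod : ∀ p : X, ∃ (V : X.Opens) (t : Γ(X, V)) (e : Fin 2 → Γ(F, V)),
      p ∈ V ∧ IsModel D L t e) (hF : IsVectorBundle F 2) :
    IsometricTo (heckeForm (traceForm F) x L) (traceForm (elementary F x 1 D)) := by
  obtain ⟨θ, hθ⟩ := exists_iso_of_correspondence
    (M := hecke (endZero F) x L) (N := endZero (elementary F x 1 D))
    (fun U ↦
      { carrier := {q | HeckeRel q.1 q.2}
        zero_mem' := fun V hV a W hW v ↦ (smul_zero _).symm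
        add_mem' := fun {q q'} h h' V hV a W hW v ↦ by
          have := congrArg₂ (· + ·) (h V hV a W hW v) (h' V hV a W hW v)
          rw [← smul_add] at this
          exact this
        smul_mem' := fun c q h V hV a W hW v ↦ by
          have := congrArg (resO (hW.trans hV) c • ·) (h V hV a W hW v)
          simp only [smul_comm _ (resO hW (idealIncl a)), ← elementaryIncl_smul] at this
          rw [← resO_resO hW hV c] at this
          exact this.trans (by rw [resO_resO]; rfl) })
    (fun V U h s f hsf W hW ↦ hsf W (hW.trans h))
    (fun U s f h V hV a W hW v ↦ by
      refine section_ext _ _ _ fun p hp ↦ ?_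
      obtain ⟨Z, hZ, hpZ, hsf⟩ := h p (hV (hW hp))
      refine ⟨W ⊓ Z, inf_le_left, ⟨hp, hpZ⟩, ?_⟩
      have := hsf (W ⊓ Z) inf_le_right (res _ (inf_le_left.trans hW) a) _ le_rfl
        (res _ inf_le_left v)
      dsimp only at this ⊢
      rw [heckeHom_res, ← res_heckeHom s hV, idealIncl_res, resO_resO] at this
      rw [res_homApp, res_smul, resO_resO]
      refine this.trans (congrArg _ ?_)
      change _ = elementaryIncl (res _ inf_le_left (homApp (endZeroHom f) (hW.trans hV) v))
      rw [res_homApp]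
      rfl)
    (fun U s h ↦ HeckeRel.eq_zero_left hmod h)
    (fun U f h ↦ HeckeRel.eq_zero_right hmod h)
    (fun U s p hp ↦ by
      obtain ⟨V, hV, t, e, hpV, hm⟩ := exists_isModel_le hmod hp
      exact ⟨V, hV, hpV, hm.exists_heckeRel_right hmod _⟩)
    (fun U f p hp ↦ ⟨U, le_rfl, hp, by
      rw [res_self]
      exact exists_heckeRel_left hmod hF f⟩)
  exact ⟨θ, fun U s s' ↦ heckeForm_eq_of_heckeRel hmod hF (hθ U s) (hθ U s')⟩

end Model

/-! ### Lengths of submodules -/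

section Length

variable {R P : Type*} [CommRing R] [AddCommGroup P] [Module R P]

/-- Adding a generator which is killed by a maximal ideal modulo `N` increases the length by at
most one. -/
theorem length_sup_span_le (m : Ideal R) [m.IsMaximal] (N : Submodule R P) (y : P)
    (hy : ∀ r ∈ m, r • y ∈ N) :
    Module.length R (N ⊔ R ∙ y : Submodule R P) ≤ Module.length R N + 1 := by
  set S := N ⊔ R ∙ y with hS
  have hyS : y ∈ S := le_sup_right (a := N) (Submodule.mem_span_singleton_self y)
  let A : Submodule R S := N.comap S.subtype
  rw [Module.length_eq_add_of_exact A.subtype A.mkQ A.injective_subtype A.mkQ_surjective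
    (LinearMap.exact_subtype_mkQ A)]
  have e : Module.length R A = Module.length R N :=
    (Submodule.comapSubtypeEquivOfLe (le_sup_left : N ≤ S)).length_eq
  rw [e]
  gcongr
  -- The map `r ↦ r y` onto `S / A` kills `m`, so `S / A` is a quotient of the simple module `R /
  -- m`.
  let g : R →ₗ[R] S ⧸ A := A.mkQ ∘ₗ LinearMap.toSpanSingleton R S ⟨y, hyS⟩
  have hg : m ≤ LinearMap.ker g := fun r hr ↦ by
    change A.mkQ (r • ⟨y, hyS⟩) = 0
    rw [Submodule.mkQ_apply, Submodule.Quotient.mk_eq_zero]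
    exact hy r hr
  have : IsSimpleModule R (R ⧸ m) := isSimpleModule_iff_isCoatom.2 (Ideal.isMaximal_def.1 ‹_›)
  rw [← Module.length_eq_one R (R ⧸ m)]
  refine Module.length_le_of_surjective (Submodule.liftQ m g hg) ?_
  rw [← LinearMap.range_eq_top, Submodule.range_liftQ, LinearMap.range_eq_top]
  intro q
  obtain ⟨⟨z, hz⟩, rfl⟩ := A.mkQ_surjective q
  obtain ⟨n, hn, w, hw, rfl⟩ := Submodule.mem_sup.1 hz
  obtain ⟨r, rfl⟩ := Submodule.mem_span_singleton.1 hw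
  refine ⟨r, ?_⟩
  change A.mkQ (r • ⟨y, hyS⟩) = A.mkQ _
  rw [← sub_eq_zero, ← map_sub, Submodule.mkQ_apply, Submodule.Quotient.mk_eq_zero]
  change r • y - (n + r • y) ∈ N
  rw [sub_add_cancel_right]
  exact N.neg_mem hn

/-- Additivity of length makes the quotient of length zero; finiteness of `k` is what allows
cancellation in `ℕ∞`. -/
theorem eq_of_le_of_length_le {L N : Submodule R P} (h : L ≤ N) (k : ℕ)
    (hL : Module.length R L = k) (hN : Module.length R N ≤ k) : L = N := by
  let A : Submodule R N := L.comap N.subtype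
  have e : Module.length R A = Module.length R L :=
    (Submodule.comapSubtypeEquivOfLe h).length_eq
  rw [Module.length_eq_add_of_exact A.subtype A.mkQ A.injective_subtype A.mkQ_surjective
    (LinearMap.exact_subtype_mkQ A), e, hL] at hN
  have h0 : Module.length R (N ⧸ A) = 0 := by
    have : (k : ℕ∞) + Module.length R (N ⧸ A) ≤ k + 0 := by simpa using hN
    exact nonpos_iff_eq_zero.1 ((ENat.add_le_add_iff_left (ENat.natCast_ne_top k)).1 this)
  rw [Module.length_eq_zero_iff, Submodule.Quotient.subsingleton_iff] at h0
  refine le_antisymm h fun z hz ↦ ?_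
  have : (⟨z, hz⟩ : N) ∈ A := h0 ▸ trivial
  exact this

end Length

/-! ### Local generators and the maximal ideal of the stalk -/

section Generator

variable {X : Scheme.{u}} {V W : X.Opens} {x : X} {t : Γ(X, V)}

theorem germO_eq_iff {U V : X.Opens} (hU : x ∈ U) (hV : x ∈ V) (a : Γ(X, U)) (b : Γ(X, V)) :
    germO hU a = germO hV b ↔ ∃ (W : X.Opens) (_ : x ∈ W) (h : W ≤ U) (h' : W ≤ V),
      resO h a = resO h' b := by
  constructor
  · intro h
    obtain ⟨W, hW, i, j, h⟩ := TopCat.Presheaf.germ_eq X.presheaf x hU hV a b h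
    exact ⟨W, hW, leOfHom i, leOfHom j, h⟩
  · rintro ⟨W, hW, i, j, h⟩
    rw [← germO_res i hW, h, germO_res]

theorem germ_eq_iff (M : X.Modules) {U V : X.Opens} (hU : x ∈ U) (hV : x ∈ V) (a : Γ(M, U))
    (b : Γ(M, V)) : germ M hU a = germ M hV b ↔
      ∃ (W : X.Opens) (_ : x ∈ W) (h : W ≤ U) (h' : W ≤ V), res M h a = res M h' b := by
  constructor
  · intro h
    obtain ⟨W, hW, i, j, h⟩ := TopCat.Presheaf.germ_eq M.presheaf x hU hV a b h
    exact ⟨W, hW, leOfHom i, leOfHom j, h⟩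
  · rintro ⟨W, hW, i, j, h⟩
    rw [← germ_res M i hW, h, germ_res]

theorem IsLocalGenerator.maxIdeal_eq (ht : IsLocalGenerator x t) (hx : x ∈ V) :
    maxIdeal x = Ideal.span {germO hx t} := by
  ext a
  obtain ⟨W, hW, hxW, a, rfl⟩ := exists_germO hx a
  rw [Ideal.mem_span_singleton]
  constructor
  · intro ha
    obtain ⟨c, rfl⟩ := (ht.mem_iff W hW a).1 fun _ ↦ ha
    rw [map_mul, germO_res hW]
    exact dvd_mul_right _ _
  · rintro ⟨c, hc⟩
    rw [hc, ← germO_res hW hxW]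
    exact Ideal.mul_mem_right _ _ ((ht.mem_iff W hW _).2 dvd_rfl hxW)

theorem IsLocalGenerator.cancel_germ (ht : IsLocalGenerator x t) (hx : x ∈ V)
    {a b : X.presheaf.stalk x} (h : germO hx t * a = germO hx t * b) : a = b := by
  obtain ⟨W, hW, hxW, a, rfl⟩ := exists_germO hx a
  obtain ⟨W', hW', hxW', b, rfl⟩ := exists_germO hxW b
  rw [← germO_res hW' hxW', ← germO_res (hW'.trans hW) hxW', ← map_mul, ← map_mul,
    germO_eq_iff] at h
  obtain ⟨Z, hxZ, hZ, _, h⟩ := h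
  rw [map_mul, map_mul, resO_resO] at h
  rw [← germO_res hW' hxW', germO_eq_iff]
  exact ⟨Z, hxZ, hZ, hZ, ht.cancel _ h⟩

/-- Divisibility by `t` is applied twice; between the two, one factor `t` is cancelled in the stalk.
The case `x ∉ W`, where the left side is vacuous, is covered because `t` then divides everything. -/
theorem IsLocalGenerator.mem_sq_iff (ht : IsLocalGenerator x t) (h : W ≤ V) (a : Γ(X, W)) :
    (∀ hx : x ∈ W, germO hx a ∈ maxIdeal x ^ 2) ↔ resO h t ^ 2 ∣ a := by
  constructor
  · intro ha
    obtain ⟨b, rfl⟩ := (ht.mem_iff W h a).1 fun hx ↦ Ideal.pow_le_self two_ne_zero (ha hx)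
    obtain ⟨c, rfl⟩ := (ht.mem_iff W h b).1 fun hx ↦ by
      have := ha hx
      rw [ht.maxIdeal_eq (h hx), Ideal.span_singleton_pow, Ideal.mem_span_singleton, map_mul,
        germO_res h hx] at this
      obtain ⟨c, hc⟩ := this
      rw [ht.maxIdeal_eq (h hx), Ideal.mem_span_singleton]
      exact ⟨c, ht.cancel_germ (h hx) (by rw [hc]; ring)⟩
    exact ⟨c, by ring⟩
  · rintro ⟨c, rfl⟩ hx
    rw [map_mul, map_pow]
    exact Ideal.mul_mem_right _ _ (Ideal.pow_mem_pow ((ht.mem_iff W h _).2 dvd_rfl hx) 2)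

/-- Away from `x` the function `1` generates the ideal sheaf of `x`. -/
theorem isLocalGenerator_one (hV : x ∉ V) : IsLocalGenerator x (1 : Γ(X, V)) where
  regular W h a ha := by rwa [map_one, one_mul] at ha
  mem_iff W h a := by
    rw [map_one]
    exact ⟨fun _ ↦ one_dvd a, fun _ hx ↦ absurd (h hx) hV⟩

theorem isUnit_of_germO (hx : x ∈ V) (a : Γ(X, V)) (ha : IsUnit (germO hx a)) :
    ∃ (W : X.Opens) (h : W ≤ V), x ∈ W ∧ IsUnit (resO h a) :=
  ⟨X.basicOpen a, X.basicOpen_le a, (X.mem_basicOpen a x hx).2 ha,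
    RingedSpace.isUnit_res_basicOpen _ a⟩

end Generator

/-! ### Fibers, jets and matrix entries in a frame -/

section Fibers

variable {X : Scheme.{u}} {F M N : X.Modules} {U V W : X.Opens} {x : X} {t : Γ(X, V)} {n : ℕ}

theorem jet_smul (M : X.Modules) (n : ℕ) (hx : x ∈ U) (a : Γ(X, U)) (s : Γ(M, U)) :
    jet M n hx (a • s) = germO hx a • jet M n hx s := by
  rw [jet, germ_smul]; rfl

theorem jet_add (M : X.Modules) (n : ℕ) (hx : x ∈ U) (s s' : Γ(M, U)) :
    jet M n hx (s + s') = jet M n hx s + jet M n hx s' := by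
  rw [jet, map_add]; rfl

theorem exists_jet (M : X.Modules) (n : ℕ) (hx : x ∈ U) (q : ThickFiber M x n) :
    ∃ (V : X.Opens) (_ : V ≤ U) (hV : x ∈ V) (s : Γ(M, V)), jet M n hV s = q := by
  obtain ⟨m, rfl⟩ := Submodule.Quotient.mk_surjective _ q
  obtain ⟨V, hV, hxV, s, rfl⟩ := exists_germ M hx m
  exact ⟨V, hV, hxV, s, rfl⟩

theorem smul_eq_zero_of_mem_pow {r : X.presheaf.stalk x} (hr : r ∈ maxIdeal x ^ n)
    (q : ThickFiber M x n) : r • q = 0 := by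
  obtain ⟨m, rfl⟩ := Submodule.Quotient.mk_surjective _ q
  rw [← Submodule.Quotient.mk_smul, Submodule.Quotient.mk_eq_zero]
  exact Submodule.smul_mem_smul hr trivial

theorem fiberMap_jet (hx : x ∈ U) (f : Γ(homSheaf M N, U)) (hV : V ≤ U) (hxV : x ∈ V)
    (s : Γ(M, V)) : fiberMap hx f (jet M 1 hxV s) = jet N 1 hxV (homApp f hV s) :=
  congrArg Submodule.Quotient.mk ((exists_stalkMap hx f).choose_spec V hV hxV s)

/-- As `𝔪` is principal, a germ in `𝔪 F_x` is `t` times a single germ, so all of its coordinates are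
divisible by `t`. -/
theorem IsLocalGenerator.repr_mem (ht : IsLocalGenerator x t) {e : Fin n → Γ(F, V)}
    (he : IsFrame F e) (hW : W ≤ V) (hx : x ∈ W) {v : Γ(F, W)} (hv : jet F 1 hx v = 0) (i : Fin n) :
    germO hx ((he.basis hW).repr v i) ∈ maxIdeal x := by
  rw [jet, Submodule.Quotient.mk_eq_zero, pow_one, ht.maxIdeal_eq (hW hx),
    Submodule.ideal_span_singleton_smul] at hv
  obtain ⟨y, -, hy⟩ := hv
  obtain ⟨W', hW', hxW', y, rfl⟩ := exists_germ F hx y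
  replace hy : germO (hW hx) t • germ F hxW' y = germ F hx v := hy
  rw [← germO_res (hW'.trans hW) hxW', ← germ_smul, germ_eq_iff] at hy
  obtain ⟨Z, hxZ, hZ, hZ', h⟩ := hy
  rw [← germO_res hZ' hxZ, ← he.repr_res hW hZ', ← h, res_smul, map_smul, Finsupp.smul_apply,
    smul_eq_mul, resO_resO]
  rw [map_mul]
  exact Ideal.mul_mem_right _ _ ((ht.mem_iff Z _ _).2 dvd_rfl hxZ)

theorem jet_eq_zero_of_repr_mem {e : Fin n → Γ(F, V)} (he : IsFrame F e) (hW : W ≤ V) (hx : x ∈ W)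
    {v : Γ(F, W)} (hv : ∀ i, germO hx ((he.basis hW).repr v i) ∈ maxIdeal x) : jet F 1 hx v = 0 := by
  rw [jet, Submodule.Quotient.mk_eq_zero, pow_one, ← (he.basis hW).sum_repr v, map_sum]
  refine Submodule.sum_mem _ fun i _ ↦ ?_
  rw [germ_smul]
  exact Submodule.smul_mem_smul (hv i) trivial

/-- Sections with invertible determinant with respect to a frame form a frame. -/
theorem IsFrame.of_isUnit_det {e : Fin n → Γ(F, V)} (he : IsFrame F e) (e' : Fin n → Γ(F, V))
    (hU : U ≤ V) (h : IsUnit (resO hU ((he.basis le_rfl).det e'))) :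
    IsFrame F (fun i ↦ res F hU (e' i)) := fun W hW ↦ by
  simp only [res_res]
  rw [(he.basis (hW.trans hU)).is_basis_iff_det]
  convert! h.map (resO hW) using 1
  rw [resO_resO, Module.Basis.det_apply, Module.Basis.det_apply, RingHom.map_det]
  congr 1
  ext i j
  simp only [Module.Basis.toMatrix_apply, RingHom.mapMatrix_apply, Matrix.map_apply]
  exact he.repr_res le_rfl _ (e' j) i

/-- The endomorphism with the matrix `!![a, b; c, -a]`. -/
noncomputable def IsFrame.matrixHom {e : Fin 2 → Γ(F, V)} (he : IsFrame F e) (a b c : Γ(X, V)) :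
    Γ(homSheaf F F, V) :=
  homMk (fun W hW ↦
    { toFun := fun v ↦ ((he.basis hW).repr v 0 * resO hW a + (he.basis hW).repr v 1 * resO hW b) •
          he.basis hW 0 + ((he.basis hW).repr v 0 * resO hW c - (he.basis hW).repr v 1 *
          resO hW a) • he.basis hW 1
      map_add' := fun v w ↦ by
        simp only [map_add, Finsupp.add_apply]
        module
      map_smul' := fun r v ↦ by
        simp only [map_smul, Finsupp.smul_apply, smul_eq_mul, RingHom.id_apply]
        module })
    fun W' W hW' hW v ↦ by
      change res F hW' (_ + _) = _ • _ + _ • _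
      simp only [map_add, res_smul, he.basis_apply, res_res, he.repr_res hW hW', map_sub, map_mul,
        resO_resO]

theorem IsFrame.homApp_matrixHom {e : Fin 2 → Γ(F, V)} (he : IsFrame F e) (a b c : Γ(X, V))
    (hW : W ≤ V) (v : Γ(F, W)) : homApp (he.matrixHom a b c) hW v =
      ((he.basis hW).repr v 0 * resO hW a + (he.basis hW).repr v 1 * resO hW b) •
          he.basis hW 0 + ((he.basis hW).repr v 0 * resO hW c - (he.basis hW).repr v 1 *
          resO hW a) • he.basis hW 1 := rfl

theorem IsFrame.exists_endZero {e : Fin 2 → Γ(F, V)} (he : IsFrame F e) (a b c : Γ(X, V)) :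
    ∃ f : Γ(endZero F, V), ∀ (W : X.Opens) (hW : W ≤ V),
      he.entry hW (res _ hW f) 0 0 = resO hW a ∧ he.entry hW (res _ hW f) 0 1 = resO hW b ∧
        he.entry hW (res _ hW f) 1 0 = resO hW c := by
  have hm : ∀ (W : X.Opens) (hW : W ≤ V),
      (he.basis hW).repr (homApp (he.matrixHom a b c) hW (he.basis hW 0)) 0 = resO hW a ∧
      (he.basis hW).repr (homApp (he.matrixHom a b c) hW (he.basis hW 1)) 0 = resO hW b ∧
      (he.basis hW).repr (homApp (he.matrixHom a b c) hW (he.basis hW 0)) 1 = resO hW c ∧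
      (he.basis hW).repr (homApp (he.matrixHom a b c) hW (he.basis hW 1)) 1 = - resO hW a := by
    intro W hW
    refine ⟨?_, ?_, ?_, ?_⟩ <;> simp [he.homApp_matrixHom]
  refine ⟨endZeroMk (he.matrixHom a b c) fun W hW m s hs ↦ ?_, fun W hW ↦
    ⟨(hm W hW).1, (hm W hW).2.1, (hm W hW).2.2.1⟩⟩
  rw [map_zero, LinearMap.trace_eq_matrix_trace _ (he.basis hW), Matrix.trace, Fin.sum_univ_two,
    Matrix.diag_apply, Matrix.diag_apply, LinearMap.toMatrix_apply, LinearMap.toMatrix_apply,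
    (hm W hW).1, (hm W hW).2.2.2, add_neg_cancel]

theorem IsFrame.endZero_ext {e : Fin 2 → Γ(F, V)} (he : IsFrame F e) (hW : W ≤ V)
    {f g : Γ(endZero F, W)} (h0 : he.entry hW f 0 0 = he.entry hW g 0 0)
    (h1 : he.entry hW f 0 1 = he.entry hW g 0 1) (h2 : he.entry hW f 1 0 = he.entry hW g 1 0) :
    f = g := by
  refine endZeroHom_injective (homSheaf_ext fun W' hW' v ↦ ?_)
  have hf := he.homApp_eq (hW'.trans hW) (res _ hW' f) v
  have hg := he.homApp_eq (hW'.trans hW) (res _ hW' g) v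
  simp only [he.entry_res hW hW', h0, h1, h2] at hf hg
  exact hf.trans hg.symm

/-- For trace-free matrices the two diagonal products are equal, hence the coefficient 2; on the
diagonal of the form this gives `2 (a² + bc)`. -/
theorem IsFrame.traceForm_eq (hF : IsVectorBundle F 2) {e : Fin 2 → Γ(F, V)} (he : IsFrame F e)
    (hW : W ≤ V) (f g : Γ(endZero F, W)) : traceForm F W f g =
      2 * (he.entry hW f 0 0 * he.entry hW g 0 0) + he.entry hW f 0 1 * he.entry hW g 1 0 +
        he.entry hW f 1 0 * he.entry hW g 0 1 := by
  have h := isTrace_trace hF (homComp (endZeroHom f) (endZeroHom g)) W le_rfl 2 _ (he.restrict hW)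
  rw [resO_self] at h
  rw [traceForm, h, homApp_homComp, LinearMap.trace_eq_matrix_trace _ (he.basis hW),
    LinearMap.toMatrix_comp _ (he.basis hW), Matrix.trace, Fin.sum_univ_two]
  simp only [Matrix.diag_apply, Matrix.mul_apply, Fin.sum_univ_two, LinearMap.toMatrix_apply]
  change he.entry hW f 0 0 * he.entry hW g 0 0 + he.entry hW f 0 1 * he.entry hW g 1 0 +
    (he.entry hW f 1 0 * he.entry hW g 0 1 + he.entry hW f 1 1 * he.entry hW g 1 1) = _
  rw [he.entry_add_entry, he.entry_add_entry]
  ring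

theorem IsFrame.entry_add {e : Fin 2 → Γ(F, V)} (he : IsFrame F e)
    (hW : W ≤ V) (f g : Γ(endZero F, W)) (i j : Fin 2) :
    he.entry hW (f + g) i j = he.entry hW f i j + he.entry hW g i j := by
  simp [entry]

theorem IsFrame.entry_smul {e : Fin 2 → Γ(F, V)} (he : IsFrame F e)
    (hW : W ≤ V) (a : Γ(X, W)) (f : Γ(endZero F, W)) (i j : Fin 2) :
    he.entry hW (a • f) i j = a * he.entry hW f i j := by
  simp [entry, resO_self]

end Fibers

/-! ### The shape of Lagrangian submodules in `OΣ₁` at `x` -/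

section AtPoint

variable {X : Scheme.{u}} {F : X.Modules} {U V W : X.Opens} {x : X}
  {L : Submodule (X.presheaf.stalk x) (ThickFiber (endZero F) x 2)}

/-- A nilpotent endomorphism has the form `e₁ ↦ e₀` in a suitable frame. -/
theorem exists_frame_of_nilpotent (hF : IsVectorBundle F 2)
    (hgen : ∀ p : X, ∃ (V : X.Opens) (t : Γ(X, V)), p ∈ V ∧ IsLocalGenerator x t)
    (hiso : ∀ (U : X.Opens) (hx : x ∈ U) (s : Γ(endZero F, U)), jet (endZero F) 2 hx s ∈ L →
      germO hx (traceForm F U s s) ∈ maxIdeal x ^ 2)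
    (h2 : IsUnit (2 : X.presheaf.stalk x)) (hx : x ∈ U) (s : Γ(endZero F, U))
    (hs : jet (endZero F) 2 hx s ∈ L) (hs0 : fiberMap hx (endZeroHom s) ≠ 0) :
    ∃ (V : X.Opens) (hV : V ≤ U) (t : Γ(X, V)) (e : Fin 2 → Γ(F, V)), x ∈ V ∧
      IsLocalGenerator x t ∧ IsFrame F e ∧ homApp (endZeroHom s) hV (e 1) = e 0 := by
  obtain ⟨V, hV, t, e, hxV, ht, he⟩ := hF.exists_frame_of_generator hgen x hx
  -- The candidate frames are `(s e_j, e_j)`. Their determinants in the old frame are `b` for `j =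
  -- 1` and `-c` for `j = 0`.
  have key : ∀ j : Fin 2, IsUnit (germO hxV ((he.basis le_rfl).det
      ![homApp (endZeroHom s) hV (he.basis le_rfl j), he.basis le_rfl j])) →
      ∃ (V : X.Opens) (hV : V ≤ U) (t : Γ(X, V)) (e : Fin 2 → Γ(F, V)), x ∈ V ∧
      IsLocalGenerator x t ∧ IsFrame F e ∧ homApp (endZeroHom s) hV (e 1) = e 0 := by
    intro j hj
    obtain ⟨W, hW, hxW, hu⟩ := isUnit_of_germO hxV _ hj
    exact ⟨W, hW.trans hV, resO hW t, _, hxW, ht.restrict hW, he.of_isUnit_det _ hW hu,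
      (res_homApp (endZeroHom s) hV hW _).symm⟩
  set s' := res (endZero F) hV s with hs'
  by_cases hb : IsUnit (germO hxV (he.entry le_rfl s' 0 1))
  · refine key 1 ?_
    convert! hb using 2
    rw [Module.Basis.det_apply, Matrix.det_fin_two]
    simp [Module.Basis.toMatrix_apply]
    rfl
  by_cases hc : IsUnit (germO hxV (he.entry le_rfl s' 1 0))
  · refine key 0 ?_
    convert! hc.neg using 1
    rw [Module.Basis.det_apply, Matrix.det_fin_two, ← map_neg]
    simp [Module.Basis.toMatrix_apply]
    rfl
  -- If neither `b` nor `c` is a unit, isotropy of `s` gives `2a² ∈ 𝔪` and hence `a ∈ 𝔪`. Every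
  -- entry then vanishes in the fiber, contradicting `φ ≠ 0`.
  exfalso
  replace hb := (IsLocalRing.mem_maximalIdeal _).2 (mem_nonunits_iff.2 hb)
  replace hc := (IsLocalRing.mem_maximalIdeal _).2 (mem_nonunits_iff.2 hc)
  have hq := hiso V hxV s' (by rw [hs', jet_res]; exact hs)
  replace hq := Ideal.pow_le_self two_ne_zero hq
  rw [he.traceForm_eq hF le_rfl] at hq
  simp only [map_add, map_mul, map_ofNat] at hq
  have ha : germO hxV (he.entry le_rfl s' 0 0) ∈ maxIdeal x := by
    have h3 := (Submodule.add_mem_iff_left _ (Ideal.mul_mem_right _ _ hc)).1 hq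
    have h4 := (Submodule.add_mem_iff_left _ (Ideal.mul_mem_right _ _ hb)).1 h3
    have h5 := (Ideal.unit_mul_mem_iff_mem _ h2).1 h4
    rcases Ideal.IsPrime.mem_or_mem inferInstance h5 with h | h <;> exact h
  refine hs0 (LinearMap.ext fun q ↦ ?_)
  obtain ⟨W, hW, hxW, v, rfl⟩ := exists_jet F 1 hxV q
  rw [fiberMap_jet hx _ (hW.trans hV) hxW, LinearMap.zero_apply]
  refine jet_eq_zero_of_repr_mem he hW hxW ?_
  have h6 := he.homApp_eq hW (res _ hW s') v
  change homApp (endZeroHom s) (hW.trans hV) v = _ at h6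
  rw [h6]
  simp only [he.entry_res le_rfl hW]
  rw [Fin.forall_fin_two]
  simp only [map_add, map_smul, Module.Basis.repr_self, Finsupp.add_apply, Finsupp.smul_apply,
    Finsupp.single_eq_same, smul_eq_mul, map_sub, map_mul, germO_res hW hxW, mul_one]
  constructor
  · simp only [ne_eq, not_false_eq_true, Finsupp.single_eq_of_ne, mul_zero, add_zero,
      zero_ne_one, map_zero]
    exact Ideal.add_mem _ (Ideal.mul_mem_left _ _ ha) (Ideal.mul_mem_left _ _ hb)
  · simp only [ne_eq, one_ne_zero, not_false_eq_true, Finsupp.single_eq_of_ne, mul_zero, zero_add,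
      map_zero]
    exact Ideal.sub_mem _ (Ideal.mul_mem_left _ _ hc) (Ideal.mul_mem_left _ _ ha)

theorem IsFrame.entry_of_homApp_eq {e : Fin 2 → Γ(F, V)} (he : IsFrame F e) (hV : V ≤ U)
    {s : Γ(endZero F, U)} (hs : homApp (endZeroHom s) hV (e 1) = e 0) (hW : W ≤ V) :
    he.entry hW (res _ (hW.trans hV) s) 0 0 = 0 ∧ he.entry hW (res _ (hW.trans hV) s) 0 1 = 1 := by
  have h1 : homApp (endZeroHom s) (hW.trans hV) (he.basis hW 1) = he.basis hW 0 := by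
    rw [he.basis_apply, he.basis_apply, ← hs, res_homApp]
  have h3 : he.entry hW (res _ (hW.trans hV) s) 1 1 = 0 := by
    change (he.basis hW).repr (homApp (endZeroHom s) (hW.trans hV) (he.basis hW 1)) 1 = 0
    rw [h1]; simp
  refine ⟨by rwa [he.entry_add_entry, neg_eq_zero] at h3, ?_⟩
  change (he.basis hW).repr (homApp (endZeroHom s) (hW.trans hV) (he.basis hW 1)) 0 = 1
  rw [h1]; simp

/-- In a frame with `φ e₁ = e₀`, the image of `φ` is spanned by `e₀`. -/
theorem jet_mem_range_iff {t : Γ(X, V)} (ht : IsLocalGenerator x t) {e : Fin 2 → Γ(F, V)}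
    (he : IsFrame F e) (hV : V ≤ U) (hx : x ∈ U) (s : Γ(endZero F, U))
    (hs : homApp (endZeroHom s) hV (e 1) = e 0)
    (hδ : ∀ hxV : x ∈ V, germO hxV (he.entry le_rfl (res _ hV s) 1 0) ∈ maxIdeal x)
    (hW : W ≤ V) (hxW : x ∈ W) (v : Γ(F, W)) :
    jet F 1 hxW v ∈ LinearMap.range (fiberMap hx (endZeroHom s)) ↔
      germO hxW ((he.basis hW).repr v 1) ∈ maxIdeal x := by
  have hsv : ∀ (Z : X.Opens) (hZ : Z ≤ V) (w : Γ(F, Z)),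
      homApp (endZeroHom s) (hZ.trans hV) w = (he.basis hZ).repr w 1 • he.basis hZ 0 +
        ((he.basis hZ).repr w 0 * resO hZ (he.entry le_rfl (res _ hV s) 1 0)) •
          he.basis hZ 1 := by
    intro Z hZ w
    have h5 := he.homApp_eq hZ (res _ (hZ.trans hV) s) w
    rw [(he.entry_of_homApp_eq hV hs hZ).1, (he.entry_of_homApp_eq hV hs hZ).2, mul_zero, zero_add,
      mul_one, mul_zero, sub_zero] at h5
    rw [← he.entry_res le_rfl hZ, res_res]
    exact h5
  constructor
  · rintro ⟨q, hq⟩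
    obtain ⟨Z, hZ, hxZ, w, rfl⟩ := exists_jet F 1 hxW q
    rw [fiberMap_jet hx _ ((hZ.trans hW).trans hV) hxZ, ← jet_res F 1 hZ hxZ v,
      eq_comm, ← sub_eq_zero] at hq
    have hq' : jet F 1 hxZ (res F hZ v - homApp (endZeroHom s) ((hZ.trans hW).trans hV) w) = 0 := by
      rw [jet, map_sub]; exact hq
    have := ht.repr_mem he (hZ.trans hW) hxZ hq' 1
    rw [hsv Z (hZ.trans hW)] at this
    simp [he.repr_res hW hZ, germO_res, -IsLocalRing.mem_maximalIdeal] at this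
    rw [Submodule.sub_mem_iff_left _ (Ideal.mul_mem_left _ _ (hδ _))] at this
    exact this
  · intro hv
    -- Since `s e₁ = e₀`, a preimage of `v₀ e₀` is `v₀ e₁`, and `v` differs from `v₀ e₀` only by `v₁
    -- e₁`, which vanishes in the fiber.
    refine ⟨germO hxW ((he.basis hW).repr v 0) • jet F 1 hxW (he.basis hW 1), ?_⟩
    rw [map_smul, fiberMap_jet hx _ (hW.trans hV), hsv W hW, ← sub_eq_zero, ← jet_smul]
    have : jet F 1 hxW ((he.basis hW).repr v 0 • ((he.basis hW).repr (he.basis hW 1) 1 •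
        he.basis hW 0 + ((he.basis hW).repr (he.basis hW 1) 0 * resO hW
          (he.entry le_rfl (res _ hV s) 1 0)) • he.basis hW 1) - v) = 0 := by
      refine jet_eq_zero_of_repr_mem he hW hxW ?_
      rw [Fin.forall_fin_two]
      simp
      exact hv
    rw [← this, jet, jet, jet, map_sub]
    rfl

theorem IsFrame.jet_endZero_eq (x : X) {e : Fin 2 → Γ(F, V)} (he : IsFrame F e) :
    ∃ h y z : ThickFiber (endZero F) x 2, ∀ (W : X.Opens) (hW : W ≤ V) (hxW : x ∈ W)
      (f : Γ(endZero F, W)), jet (endZero F) 2 hxW f = germO hxW (he.entry hW f 0 0) • h +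
        germO hxW (he.entry hW f 0 1) • y + germO hxW (he.entry hW f 1 0) • z := by
  by_cases hx : x ∈ V
  · obtain ⟨h, hh⟩ := he.exists_endZero 1 0 0
    obtain ⟨y, hy⟩ := he.exists_endZero 0 1 0
    obtain ⟨z, hz⟩ := he.exists_endZero 0 0 1
    refine ⟨jet _ 2 hx h, jet _ 2 hx y, jet _ 2 hx z, fun W hW hxW f ↦ ?_⟩
    have : f = he.entry hW f 0 0 • res _ hW h + he.entry hW f 0 1 • res _ hW y +
        he.entry hW f 1 0 • res _ hW z := by
      refine he.endZero_ext hW ?_ ?_ ?_ <;>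
      simp only [he.entry_add, he.entry_smul, hh W hW, hy W hW, hz W hW, map_one, map_zero,
        mul_one, mul_zero, add_zero, zero_add]
    conv_lhs => rw [this]
    rw [jet_add, jet_add, jet_smul, jet_smul, jet_smul, jet_res, jet_res, jet_res]
  · exact ⟨0, 0, 0, fun W hW hxW ↦ absurd (hW hxW) hx⟩

/-- The Lagrangian submodules in `OΣ₁`, in a frame with `φ e₁ = e₀`. -/
theorem jet_mem_iff_of_isLagrangian (hF : IsVectorBundle F 2)
    (hL : IsLagrangian (traceForm F) 3 x L) (h2 : IsUnit (2 : X.presheaf.stalk x))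
    {t : Γ(X, V)} (ht : IsLocalGenerator x t) {e : Fin 2 → Γ(F, V)}
    (he : IsFrame F e) (hV : V ≤ U) (hx : x ∈ U) (hxV : x ∈ V) (s : Γ(endZero F, U))
    (hs : homApp (endZeroHom s) hV (e 1) = e 0) (hsL : jet (endZero F) 2 hx s ∈ L)
    (hδ : germO hxV (he.entry le_rfl (res _ hV s) 1 0) ∈ maxIdeal x ^ 2)
    (hfib : ∀ (W : X.Opens) (hxW : x ∈ W) (f : Γ(endZero F, W)), jet (endZero F) 2 hxW f ∈ L →
      ∃ r : X.presheaf.stalk x, fiberMap hxW (endZeroHom f) = r • fiberMap hx (endZeroHom s))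
    (hW : W ≤ V) (hxW : x ∈ W) (f : Γ(endZero F, W)) :
    jet (endZero F) 2 hxW f ∈ L ↔ germO hxW (he.entry hW f 0 0) ∈ maxIdeal x ∧
      germO hxW (he.entry hW f 1 0) ∈ maxIdeal x ^ 2 := by
  have hδW : ∀ (W : X.Opens) (hW : W ≤ V) (hxW : x ∈ W),
      germO hxW (he.entry hW (res _ (hW.trans hV) s) 1 0) ∈ maxIdeal x ^ 2 := fun W hW hxW ↦ by
    rw [← res_res _ hW hV, he.entry_res le_rfl hW, germO_res]
    exact hδ
  have hq : ∀ (W : X.Opens) (hW : W ≤ V) (hxW : x ∈ W) (f : Γ(endZero F, W)),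
      jet (endZero F) 2 hxW f ∈ L →
      germO hxW (he.entry hW f 0 0) * germO hxW (he.entry hW f 0 0) +
        germO hxW (he.entry hW f 0 1) * germO hxW (he.entry hW f 1 0) ∈ maxIdeal x ^ 2 := by
    intro W hW hxW f hf
    have := hL.1 W hxW f hf
    rw [he.traceForm_eq hF hW] at this
    simp only [map_add, map_mul, map_ofNat] at this
    rw [← Ideal.unit_mul_mem_iff_mem _ h2]
    convert this using 1
    ring
  have mp : ∀ (W : X.Opens) (hW : W ≤ V) (hxW : x ∈ W) (f : Γ(endZero F, W)),
      jet (endZero F) 2 hxW f ∈ L → germO hxW (he.entry hW f 0 0) ∈ maxIdeal x ∧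
      germO hxW (he.entry hW f 1 0) ∈ maxIdeal x ^ 2 := by
    intro W hW hxW f hf
    obtain ⟨h00, h01⟩ := he.entry_of_homApp_eq hV hs hW
    constructor
    -- In the fiber `f` is a multiple of `φ`, and `φ(e₀) = 0` because `s` has first column `(0, δ)`
    -- with `δ ∈ 𝔪²`. So the first column of `f` vanishes there.
    · obtain ⟨r, hr⟩ := hfib W hxW f hf
      have h1 := LinearMap.congr_fun hr (jet F 1 hxW (he.basis hW 0))
      have h3 : jet F 1 hxW (homApp (endZeroHom s) (hW.trans hV) (he.basis hW 0)) = 0 := by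
        refine jet_eq_zero_of_repr_mem he hW hxW ?_
        rw [Fin.forall_fin_two]
        change germO hxW (he.entry hW (res _ (hW.trans hV) s) 0 0) ∈ _ ∧
          germO hxW (he.entry hW (res _ (hW.trans hV) s) 1 0) ∈ _
        rw [h00, map_zero]
        exact ⟨Ideal.zero_mem _, Ideal.pow_le_self two_ne_zero (hδW W hW hxW)⟩
      rw [LinearMap.smul_apply, fiberMap_jet hxW _ le_rfl hxW, fiberMap_jet hx _ (hW.trans hV) hxW,
        h3, smul_zero] at h1
      exact ht.repr_mem he hW hxW h1 0
    -- Polarization against `s`: the difference of the quadratic forms of `f + s` and `f` is `c + bδ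
    -- + δ` after division by 2. Both `bδ` and `δ` lie in `𝔪²`, so `c` does too.
    · have hf' : jet (endZero F) 2 hxW (f + res _ (hW.trans hV) s) ∈ L := by
        rw [jet_add, jet_res]
        exact L.add_mem hf hsL
      have q1 := hq W hW hxW f hf
      have q2 := hq W hW hxW _ hf'
      simp only [he.entry_add, h00, h01, map_add, add_zero, map_one] at q2
      have q3 := Ideal.mul_mem_left _ (germO hxW (he.entry hW f 0 1)) (hδW W hW hxW)
      have q4 := Ideal.sub_mem _ (Ideal.sub_mem _ (Ideal.sub_mem _ q2 q1) q3) (hδW W hW hxW)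
      convert q4 using 1
      ring
  refine ⟨mp W hW hxW f, fun ⟨ha, hc⟩ ↦ ?_⟩
  obtain ⟨h, y, z, hhyz⟩ := he.jet_endZero_eq x
  set τ := germO hxV t with hτ
  have hm : ∀ r ∈ maxIdeal x, ∃ c, r = c * τ := fun r hr ↦ by
    rw [ht.maxIdeal_eq hxV, Ideal.mem_span_singleton] at hr
    obtain ⟨c, rfl⟩ := hr
    exact ⟨c, mul_comm _ _⟩
  have hτm : τ ∈ maxIdeal x := by
    rw [ht.maxIdeal_eq hxV]; exact Ideal.mem_span_singleton_self _
  let O := X.presheaf.stalk x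
  -- The target module is generated by `τy`, `τh` and `y`, where `h`, `y`, `z` are the jets of the
  -- elementary matrices for `a`, `b`, `c`. Adding these generators in this order raises the length
  -- by at most one each time: `𝔪` kills `τy` and `τh` modulo `𝔪²`, and sends `y` into the span of
  -- `τy`.
  let N₁ : Submodule O (ThickFiber (endZero F) x 2) := ⊥ ⊔ O ∙ (τ • y)
  let N₂ : Submodule O (ThickFiber (endZero F) x 2) := N₁ ⊔ O ∙ (τ • h)
  let N₃ : Submodule O (ThickFiber (endZero F) x 2) := N₂ ⊔ O ∙ y
  have kill : ∀ (r : O), r ∈ maxIdeal x → ∀ q : ThickFiber (endZero F) x 2, r • τ • q = 0 :=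
    fun r hr q ↦ by
      rw [smul_smul]
      exact smul_eq_zero_of_mem_pow (pow_two (maxIdeal x) ▸ Ideal.mul_mem_mul hr hτm) q
  have l1 : Module.length O N₁ ≤ 0 + 1 := by
    refine (length_sup_span_le (maxIdeal x) ⊥ (τ • y) fun r hr ↦ ?_).trans_eq ?_
    · rw [kill r hr]; exact Submodule.zero_mem _
    · rw [Module.length_bot]
  have l2 : Module.length O N₂ ≤ 0 + 1 + 1 :=
    (length_sup_span_le (maxIdeal x) N₁ (τ • h) fun r hr ↦ by
      rw [kill r hr]; exact Submodule.zero_mem _).trans (by gcongr)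
  have l3 : Module.length O N₃ ≤ 0 + 1 + 1 + 1 :=
    (length_sup_span_le (maxIdeal x) N₂ y fun r hr ↦ by
      obtain ⟨c, rfl⟩ := hm r hr
      rw [mul_smul]
      exact Submodule.mem_sup_left (Submodule.smul_mem _ _ (Submodule.mem_sup_right
        (Submodule.mem_span_singleton_self _)))).trans (by gcongr)
  have memN : ∀ (W : X.Opens) (hW : W ≤ V) (hxW : x ∈ W) (f : Γ(endZero F, W)),
      germO hxW (he.entry hW f 0 0) ∈ maxIdeal x →
      germO hxW (he.entry hW f 1 0) ∈ maxIdeal x ^ 2 → jet (endZero F) 2 hxW f ∈ N₃ := by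
    intro W hW hxW f ha hc
    rw [hhyz W hW hxW f, smul_eq_zero_of_mem_pow hc z, add_zero]
    obtain ⟨c, hc⟩ := hm _ ha
    rw [hc, mul_smul]
    exact Submodule.add_mem_sup (Submodule.mem_sup_right (Submodule.smul_mem _ _
      (Submodule.mem_span_singleton_self _))) (Submodule.smul_mem _ _
        (Submodule.mem_span_singleton_self _))
  have hLN : L ≤ N₃ := fun q hq ↦ by
    obtain ⟨W, hW, hxW, g, rfl⟩ := exists_jet (endZero F) 2 hxV q
    obtain ⟨h1, h3⟩ := mp W hW hxW g hq
    exact memN W hW hxW g h1 h3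
  -- The containment of `L` is an equality because `L` has the full length 3.
  rw [eq_of_le_of_length_le hLN 3 hL.2 (l3.trans (by norm_num))]
  exact memN W hW hxW f ha hc

/-- The local description of the elementary transforms at `x`. -/
theorem exists_isModel_self (hF : IsVectorBundle F 2)
    (hgen : ∀ p : X, ∃ (V : X.Opens) (t : Γ(X, V)), p ∈ V ∧ IsLocalGenerator x t)
    (hL : IsLagrangian (traceForm F) 3 x L) (h2 : IsUnit (2 : X.presheaf.stalk x))
    (φ : Module.End (X.presheaf.stalk x) (ThickFiber F x 1)) (hφ : φ ≠ 0)
    (hLφ : fiberImage L = (Submodule.span (X.presheaf.stalk x) {φ} : Set _)) :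
    ∃ (V : X.Opens) (t : Γ(X, V)) (e : Fin 2 → Γ(F, V)), x ∈ V ∧
      IsModel (LinearMap.range φ) L t e := by
  obtain ⟨U, hx, s, hsL, rfl⟩ : φ ∈ fiberImage L := by
    rw [hLφ]; exact Submodule.mem_span_singleton_self φ
  obtain ⟨V, hV, t, e, hxV, ht, he, hs⟩ := exists_frame_of_nilpotent hF hgen hL.1 h2 hx s hsL hφ
  -- Isotropy of `s = (0, 1; δ, 0)` reads `2δ ∈ 𝔪²`.
  have hδ : germO hxV (he.entry le_rfl (res _ hV s) 1 0) ∈ maxIdeal x ^ 2 := by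
    have := hL.1 V hxV (res _ hV s) (by rw [jet_res]; exact hsL)
    obtain ⟨h00, h01⟩ := he.entry_of_homApp_eq hV hs le_rfl
    rw [he.traceForm_eq hF le_rfl, h00, h01] at this
    rw [← Ideal.unit_mul_mem_iff_mem _ h2]
    convert this using 1
    simp only [map_add, map_mul, map_ofNat, map_zero, map_one]
    ring
  have hfib : ∀ (W : X.Opens) (hxW : x ∈ W) (f : Γ(endZero F, W)), jet (endZero F) 2 hxW f ∈ L →
      ∃ r : X.presheaf.stalk x, fiberMap hxW (endZeroHom f) = r • fiberMap hx (endZeroHom s) :=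
    fun W hxW f hf ↦ by
      have : fiberMap hxW (endZeroHom f) ∈ fiberImage L := ⟨W, hxW, f, hf, rfl⟩
      rw [hLφ] at this
      obtain ⟨r, hr⟩ := Submodule.mem_span_singleton.1 this
      exact ⟨r, hr.symm⟩
  refine ⟨V, t, e, hxV, ht, he, fun W hW v ↦ ?_, fun W hW f ↦ ?_⟩
  · rw [← ht.mem_iff W hW]
    exact forall_congr' fun hxW ↦ jet_mem_range_iff ht he hV hx s hs
      (fun _ ↦ Ideal.pow_le_self two_ne_zero hδ) hW hxW v
  · rw [← ht.mem_iff W hW, ← ht.mem_sq_iff hW, ← forall_and]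
    exact forall_congr' fun hxW ↦ jet_mem_iff_of_isLagrangian hF hL h2 ht he hV hx hxV s hs hsL hδ
      hfib hW hxW f

/-- The local description of the elementary transforms away from `x`. -/
theorem exists_isModel_of_ne (hF : IsVectorBundle F 2) (hx : IsClosed ({x} : Set X))
    (D : Submodule (X.presheaf.stalk x) (ThickFiber F x 1))
    (L : Submodule (X.presheaf.stalk x) (ThickFiber (endZero F) x 2)) {p : X} (hp : p ≠ x) :
    ∃ (V : X.Opens) (t : Γ(X, V)) (e : Fin 2 → Γ(F, V)), p ∈ V ∧ IsModel D L t e := by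
  obtain ⟨V, e, hpV, he⟩ := hF p
  let Z : X.Opens := ⟨{x}ᶜ, hx.isOpen_compl⟩
  have hxZ : x ∉ V ⊓ Z := fun h ↦ h.2 rfl
  -- Away from `x` both elementary transforms are trivial, so the model holds with `t = 1`.
  exact ⟨V ⊓ Z, 1, _, ⟨hpV, hp⟩, isLocalGenerator_one hxZ, he.restrict inf_le_left,
    fun W hW v ↦ ⟨fun _ ↦ by rw [map_one]; exact one_dvd _, fun _ h ↦ absurd (hW h) hxZ⟩,
    fun W hW f ↦ ⟨fun _ ↦ by rw [map_one, one_pow]; exact ⟨one_dvd _, one_dvd _⟩,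
      fun _ h ↦ absurd (hW h) hxZ⟩⟩

end AtPoint

/-! ### Uniformizers on a smooth curve -/

section Uniformizer

/-- A maximal ideal of a smooth algebra of dimension one over an algebraically closed field is
principal modulo its square. -/
theorem exists_span_sup_sq {K A : Type*} [Field K] [IsAlgClosed K] [CommRing A] [Algebra K A]
    [Algebra.IsStandardSmoothOfRelativeDimension 1 K A] (p : Ideal A) [p.IsMaximal] :
    ∃ t ∈ p, p ≤ Ideal.span {t} ⊔ p ^ 2 := by
  have : Algebra.IsStandardSmooth K A :=
    Algebra.IsStandardSmoothOfRelativeDimension.isStandardSmooth 1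
  have : Nontrivial A := (Ideal.Quotient.mk p).domain_nontrivial
  let : Field (A ⧸ p) := Ideal.Quotient.field p
  have : Module.Finite K (A ⧸ p) := finite_of_finite_type_of_isJacobsonRing K (A ⧸ p)
  have hbij : Function.Bijective (algebraMap K (A ⧸ p)) :=
    IsAlgClosed.algebraMap_bijective_of_isIntegral
  let e : K ≃ₐ[K] A ⧸ p := AlgEquiv.ofBijective (Algebra.ofId K (A ⧸ p)) hbij
  -- By the Nullstellensatz the residue field is `K`, so `r` is evaluation at the point.
  let r : A →ₐ[K] K := e.symm.toAlgHom.comp (Ideal.Quotient.mkₐ K p)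
  have hr0 : ∀ a ∈ p, r a = 0 := fun a ha ↦ by
    change e.symm (Ideal.Quotient.mk p a) = 0
    rw [Ideal.Quotient.eq_zero_iff_mem.2 ha, map_zero]
  have hr : ∀ a, a - algebraMap K A (r a) ∈ p := fun a ↦ by
    rw [← Ideal.Quotient.eq_zero_iff_mem, map_sub, sub_eq_zero]
    exact (e.apply_symm_apply (Ideal.Quotient.mk p a)).symm
  let D₀ : A →ₗ[K] p :=
    { toFun := fun a ↦ ⟨a - algebraMap K A (r a), hr a⟩
      map_add' := fun a b ↦ Subtype.ext (by simp; ring)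
      map_smul' := fun c a ↦ Subtype.ext (by simp [Algebra.smul_def, mul_sub]) }
  -- The derivation is `a ↦ a - a(p)` modulo `p²`; the defect in the Leibniz rule is `-(a - a(p))(b
  -- - b(p))`, which lies in `p²`.
  let D : Derivation K A p.Cotangent := Derivation.mk' (p.toCotangent.restrictScalars K ∘ₗ D₀)
    fun a b ↦ by
      change p.toCotangent (D₀ (a * b)) = a • p.toCotangent (D₀ b) + b • p.toCotangent (D₀ a)
      rw [← p.toCotangent.map_smul, ← p.toCotangent.map_smul, ← map_add, Ideal.toCotangent_eq]
      change (a * b - algebraMap K A (r (a * b))) - (a * (b - algebraMap K A (r b)) +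
        b * (a - algebraMap K A (r a))) ∈ p ^ 2
      rw [map_mul, map_mul, pow_two]
      convert (p * p).neg_mem (Ideal.mul_mem_mul (hr a) (hr b)) using 1
      ring
  obtain ⟨ω, -, hω⟩ := rank_eq_one_iff.1
    ((Algebra.IsStandardSmoothOfRelativeDimension.rank_kaehlerDifferential (R := K) (S := A) 1).trans
      Nat.cast_one)
  -- Choose `t` as a lift of the image of a generator `ω` of the differentials. For `a ∈ p` the
  -- class of `a` is the image of `da = c ω`, hence `c t`.
  obtain ⟨⟨t, ht⟩, htω⟩ := p.toCotangent_surjective (D.liftKaehlerDifferential ω)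
  refine ⟨t, ht, fun a ha ↦ ?_⟩
  obtain ⟨c, hc⟩ := hω (KaehlerDifferential.D K A a)
  have h1 : D a = c • p.toCotangent ⟨t, ht⟩ := by
    rw [htω, ← map_smul, hc, Derivation.liftKaehlerDifferential_comp_D]
  have h2 : D a = p.toCotangent ⟨a, ha⟩ := by
    change p.toCotangent (D₀ a) = _
    congr 1
    exact Subtype.ext (by change a - algebraMap K A (r a) = a; rw [hr0 a ha, map_zero, sub_zero])
  rw [h2, ← map_smul, Ideal.toCotangent_eq] at h1
  have h3 : a = c * t + (a - c * t) := by ring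
  rw [h3]
  exact Submodule.add_mem_sup (Ideal.mul_mem_left _ _ (Ideal.mem_span_singleton_self t)) h1

/-- Nakayama's lemma, after extending the inclusion to the local ring. -/
theorem maximalIdeal_eq_span_of_le_sup_sq {A O : Type*} [CommRing A] [CommRing O] [IsLocalRing O]
    [IsNoetherianRing O] [Algebra A O] (p : Ideal A) [p.IsPrime] [IsLocalization.AtPrime O p] {t : A}
    (ht : t ∈ p) (htp : p ≤ Ideal.span {t} ⊔ p ^ 2) :
    IsLocalRing.maximalIdeal O = Ideal.span {algebraMap A O t} := by
  have hmap : Ideal.map (algebraMap A O) p = IsLocalRing.maximalIdeal O :=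
    IsLocalization.AtPrime.map_eq_maximalIdeal p O
  apply le_antisymm
  · refine Submodule.le_of_le_smul_of_le_jacobson_bot (I := IsLocalRing.maximalIdeal O)
      (IsNoetherian.noetherian _) (IsLocalRing.maximalIdeal_le_jacobson _) ?_
    have := Ideal.map_mono (f := algebraMap A O) htp
    rw [Ideal.map_sup, Ideal.map_pow, Ideal.map_span, hmap, Set.image_singleton, pow_two] at this
    exact this
  · rw [Ideal.span_singleton_le_iff_mem, ← hmap]
    exact Ideal.mem_map_of_mem _ ht

theorem exists_span_sup_sq_of_ringHom {K A : Type*} [Field K] [IsAlgClosed K] [CommRing A]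
    {g : K →+* A} (hg : g.IsStandardSmoothOfRelativeDimension 1) (p : Ideal A) [p.IsMaximal] :
    ∃ t ∈ p, p ≤ Ideal.span {t} ⊔ p ^ 2 := by
  let := g.toAlgebra
  have : Algebra.IsStandardSmoothOfRelativeDimension 1 K A := hg
  exact exists_span_sup_sq (K := K) p

variable {X : Scheme.{u}} {x : X}

theorem exists_affine_isStandardSmooth {K : Type u} [Field K] (π : X ⟶ Spec (.of K))
    [SmoothOfRelativeDimension 1 π] (x : X) :
    ∃ (V : X.Opens) (_ : IsAffineOpen V) (_ : x ∈ V) (g : K →+* Γ(X, V)),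
      g.IsStandardSmoothOfRelativeDimension 1 := by
  obtain ⟨U, hU, V, hV, hxV, e, h⟩ :=
    SmoothOfRelativeDimension.exists_isStandardSmoothOfRelativeDimension (n := 1) (f := π) x
  -- `Spec K` has a single point, so the affine open of the base is everything and its ring of
  -- functions is `K`.
  have hUtop : U = ⊤ := by
    refine eq_top_iff.2 fun y _ ↦ ?_
    rw [Subsingleton.elim y (π x)]
    exact e hxV
  subst hUtop
  exact ⟨V, hV, hxV, _, h.comp (RingHom.IsStandardSmoothOfRelativeDimension.equiv
    (Scheme.ΓSpecIso (.of K)).commRingCatIsoToRingEquiv.symm)⟩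

theorem maxIdeal_eq_span_of_isAffineOpen [IsLocallyNoetherian X] {V : X.Opens}
    (hV : IsAffineOpen V) (y : V) {t : Γ(X, V)} (p : Ideal Γ(X, V))
    (hp : p = (hV.primeIdealOf y).asIdeal) (ht : t ∈ p) (htp : p ≤ Ideal.span {t} ⊔ p ^ 2) :
    maxIdeal y.1 = Ideal.span {germO y.2 t} := by
  have h := hV.isLocalization_stalk y
  have : p.IsPrime := hp ▸ inferInstance
  simp only [← hp] at h
  exact maximalIdeal_eq_span_of_le_sup_sq p ht htp

/-- The maximal ideal at a closed point of a smooth curve is principal. -/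
theorem exists_maxIdeal_eq_span [IsLocallyNoetherian X] {K : Type u} [Field K] [IsAlgClosed K]
    (π : X ⟶ Spec (.of K)) [SmoothOfRelativeDimension 1 π] (x : X) (hx : IsClosed ({x} : Set X)) :
    ∃ (V : X.Opens) (_ : IsAffineOpen V) (hxV : x ∈ V) (t : Γ(X, V)),
      maxIdeal x = Ideal.span {germO hxV t} := by
  obtain ⟨V, hV, hxV, g, hg⟩ := exists_affine_isStandardSmooth π x
  have : (hV.primeIdealOf ⟨x, hxV⟩).asIdeal.IsMaximal := hV.primeIdealOf_isMaximal_of_isClosed _ hx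
  obtain ⟨t, ht, htp⟩ := exists_span_sup_sq_of_ringHom hg (hV.primeIdealOf ⟨x, hxV⟩).asIdeal
  exact ⟨V, hV, hxV, t, maxIdeal_eq_span_of_isAffineOpen hV ⟨x, hxV⟩ _ rfl ht htp⟩

/-- A generator of the maximal ideal at a closed point generates the ideal sheaf nearby. -/
theorem exists_isLocalGenerator [IsIntegral X] [IsLocallyNoetherian X]
    (hx : IsClosed ({x} : Set X)) {V : X.Opens} (hV : IsAffineOpen V) (hxV : x ∈ V) (t : Γ(X, V))
    (ht : maxIdeal x = Ideal.span {germO hxV t}) (hx0 : maxIdeal x ≠ ⊥) :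
    ∃ (W : X.Opens) (t : Γ(X, W)), x ∈ W ∧ IsLocalGenerator x t := by
  have : IsNoetherianRing Γ(X, V) := IsLocallyNoetherian.component_noetherian ⟨V, hV⟩
  let p : Ideal Γ(X, V) := (maxIdeal x).comap (germO hxV)
  -- Finitely many functions generate the ideal of `x` in `V`, so a single shrinking makes `t`
  -- divide all of them.
  obtain ⟨S, hS⟩ := IsNoetherian.noetherian p
  have hdvd : ∀ g ∈ S, ∃ (W : X.Opens) (hW : W ≤ V), x ∈ W ∧ resO hW t ∣ resO hW g := by
    intro g hg
    have hgp : g ∈ p := hS ▸ Submodule.subset_span hg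
    replace hgp : germO hxV g ∈ maxIdeal x := hgp
    rw [ht, Ideal.mem_span_singleton] at hgp
    obtain ⟨c, hc⟩ := hgp
    obtain ⟨W, hW, hxW, c, rfl⟩ := exists_germO hxV c
    rw [← germO_res hW hxW t, ← map_mul, germO_eq_iff] at hc
    obtain ⟨Z, hxZ, hZ, hZ', h⟩ := hc
    exact ⟨Z, hZ, hxZ, resO hZ' c, by rw [h, map_mul, resO_resO]⟩
  have hW : ∃ (W : X.Opens) (hW : W ≤ V), x ∈ W ∧ ∀ g ∈ S, resO hW t ∣ resO hW g := by
    classical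
    clear hS
    induction S using Finset.induction_on with
    | empty => exact ⟨V, le_rfl, hxV, by simp⟩
    | insert g S _ ih =>
      obtain ⟨W, hW, hxW, h⟩ := ih fun g hg ↦ hdvd g (Finset.mem_insert_of_mem hg)
      obtain ⟨Z, hZ, hxZ, h'⟩ := hdvd g (Finset.mem_insert_self _ _)
      refine ⟨W ⊓ Z, inf_le_left.trans hW, ⟨hxW, hxZ⟩, fun g' hg' ↦ ?_⟩
      rcases Finset.mem_insert.1 hg' with rfl | hg'
      · have := map_dvd (resO (inf_le_right : W ⊓ Z ≤ Z)) h'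
        rwa [resO_resO, resO_resO] at this
      · have := map_dvd (resO (inf_le_left : W ⊓ Z ≤ W)) (h g' hg')
        rwa [resO_resO, resO_resO] at this
  obtain ⟨W, hW, hxW, hdvd⟩ := hW
  have hdvd' : ∀ f ∈ p, resO hW t ∣ resO hW f := by
    have : p ≤ (Ideal.span {resO hW t}).comap (resO hW) := by
      rw [← hS, Submodule.span_le]
      exact fun g hg ↦ Ideal.mem_span_singleton.2 (hdvd g hg)
    exact fun f hf ↦ Ideal.mem_span_singleton.1 (this hf)
  have hunit : ∀ q (hq : q ∈ W), q ≠ x → IsUnit (germO hq (resO hW t)) := by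
    intro q hq hqx
    let Z : X.Opens := ⟨{x}ᶜ, hx.isOpen_compl⟩
    -- Some function on `V` vanishes at `x` but not at `q`; since `t` divides it on `W`, `t` is a
    -- unit at `q`.
    obtain ⟨f, hf, hqf⟩ := hV.exists_basicOpen_le (V := Z) ⟨q, hqx⟩ (hW hq)
    have hfp : f ∈ p := by
      change germO hxV f ∈ maxIdeal x
      rw [IsLocalRing.mem_maximalIdeal, mem_nonunits_iff]
      intro hu
      exact hf ((X.mem_basicOpen f x hxV).2 hu) rfl
    have hu : IsUnit (germO (hW hq) f) := (X.mem_basicOpen f q (hW hq)).1 hqf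
    rw [← germO_res hW hq] at hu
    exact isUnit_of_dvd_unit (map_dvd (germO hq) (hdvd' f hfp)) hu
  have hreg : ∀ (Z : X.Opens) (h : Z ≤ W) (a : Γ(X, Z)), resO h (resO hW t) * a = 0 → a = 0 := by
    intro Z h a ha
    refine function_ext _ _ fun q hq ↦ ?_
    have hne : Nonempty Z := ⟨⟨q, hq⟩⟩
    refine ⟨Z, le_rfl, hq, ?_⟩
    -- On an integral scheme, if `t` vanished on a nonempty open set it would be zero, and the
    -- maximal ideal with it.
    rcases mul_eq_zero.1 ha with h0 | h0
    · exfalso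
      rw [resO_resO] at h0
      have ht0 : t = 0 := map_injective_of_isIntegral X (homOfLE (h.trans hW))
        (h0.trans (map_zero _).symm)
      rw [ht0, map_zero, Ideal.span_singleton_eq_bot.2 rfl] at ht
      exact hx0 ht
    · rw [h0]
  refine ⟨W, resO hW t, hxW, hreg, fun Z h a ↦ ⟨fun ha ↦ ?_, ?_⟩⟩
  · have hloc : ∀ q ∈ Z, ∃ (Y : X.Opens) (hY : Y ≤ Z), q ∈ Y ∧
        ∃ c, resO hY a = resO (hY.trans h) (resO hW t) * c := by
      intro q hq
      by_cases hqx : q = x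
      · subst hqx
        have := ha hq
        rw [ht, Ideal.mem_span_singleton] at this
        obtain ⟨c, hc⟩ := this
        obtain ⟨Y, hY, hqY, c, rfl⟩ := exists_germO hq c
        rw [← germO_res (hY.trans (h.trans hW)) hqY t, ← map_mul, germO_eq_iff] at hc
        obtain ⟨Y', hqY', i, j, hc⟩ := hc
        exact ⟨Y', i, hqY', resO j c, by rw [hc, map_mul, resO_resO, resO_resO]⟩
      · obtain ⟨Y, hY, hqY, hu⟩ := isUnit_of_germO (h hq) _ (hunit q (h hq) hqx)
        refine ⟨Z ⊓ Y, inf_le_left, ⟨hq, hqY⟩, ?_⟩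
        have hu' := hu.map (resO (inf_le_right : Z ⊓ Y ≤ Y))
        rw [resO_resO] at hu'
        exact hu'.dvd
    choose! Y hY hqY c hc using hloc
    have hcancel : ∀ (Z : X.Opens) (h : Z ≤ W) (a b : Γ(X, Z)),
        resO h (resO hW t) * a = resO h (resO hW t) * b → a = b := fun Z h a b hab ↦
      sub_eq_zero.1 (hreg Z h _ (by rw [mul_sub, hab, sub_self]))
    obtain ⟨d, hd⟩ : ∃ d : Γ(X, Z), ∀ q : Z, resO (hY q.1 q.2) d = c q.1 :=
      -- The local quotients by `t` glue, because regularity makes each of them unique.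
      (TopCat.Sheaf.existsUnique_gluing' X.sheaf (fun q : Z ↦ Y q.1) Z
      (fun q ↦ homOfLE (hY q.1 q.2)) (fun q hq ↦ Opens.mem_iSup.2 ⟨⟨q, hq⟩, hqY q hq⟩)
      (fun q ↦ c q.1) (fun q q' ↦ by
        apply hcancel _ (inf_le_left.trans ((hY q.1 q.2).trans h))
        have h1 := congrArg (resO (inf_le_left : Y q.1 ⊓ Y q'.1 ≤ Y q.1)) (hc q.1 q.2)
        have h2 := congrArg (resO (inf_le_right : Y q.1 ⊓ Y q'.1 ≤ Y q'.1)) (hc q'.1 q'.2)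
        rw [map_mul, resO_resO, resO_resO] at h1 h2
        exact h1.symm.trans h2)).exists
    refine ⟨d, function_ext _ _ fun q hq ↦ ⟨Y q, hY q hq, hqY q hq, ?_⟩⟩
    rw [map_mul, hd ⟨q, hq⟩, hc q hq, resO_resO (hY q hq) h]
  · rintro ⟨c, rfl⟩ hxZ
    rw [map_mul, germO_res, germO_res, ht]
    exact Ideal.mul_mem_right _ _ (Ideal.mem_span_singleton_self _)

/-- If `𝔪` were zero, `E_{2x}` and `E_x` would coincide and `L` would have the same length as its
image. With lengths 3 and 1 this is impossible, so `L` itself witnesses that the local ring at `x`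
is not a field. -/
theorem maxIdeal_ne_bot {E : X.Modules} {b : Form E} {r i : ℕ} (hri : r ≠ i)
    {L : Submodule (X.presheaf.stalk x) (ThickFiber E x 2)} (hL : L ∈ OSigma b r x i) :
    maxIdeal x ≠ ⊥ := fun h0 ↦ by
  have hinj : Function.Injective (toFiber E x) := by
    refine (injective_iff_map_eq_zero _).2 fun q hq ↦ ?_
    obtain ⟨m, rfl⟩ := Submodule.Quotient.mk_surjective _ q
    replace hq : (Submodule.Quotient.mk m : ThickFiber E x 1) = 0 := hq
    rw [Submodule.Quotient.mk_eq_zero, h0, pow_one, Submodule.bot_smul, Submodule.mem_bot] at hq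
    rw [hq, Submodule.Quotient.mk_zero]
  have := (Submodule.equivMapOfInjective _ hinj L).length_eq
  rw [hL.1.2, hL.2] at this
  exact hri (by exact_mod_cast this)

/-- The structure morphism makes the stalk a `K`-algebra, and 2 is already a unit in `K`. -/
theorem isUnit_two_stalk {K : Type u} [Field K] (hK : ringChar K ≠ 2) (π : X ⟶ Spec (.of K))
    (x : X) : IsUnit (2 : X.presheaf.stalk x) := by
  have h2 : IsUnit (2 : K) := (Ring.two_ne_zero hK).isUnit
  let g : K →+* X.presheaf.stalk x := (germO (x := x) (U := π ⁻¹ᵁ ⊤) trivial).comp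
    ((π.app ⊤).hom.comp (Scheme.ΓSpecIso (.of K)).inv.hom)
  have := h2.map g
  rwa [map_ofNat] at this

end Uniformizer

end OrthogonalHecke

/-! ### The comparison theorem -/

theorem mainTheorem10 {K : Type u} [Field K] [IsAlgClosed K] (hK : ringChar K ≠ 2)
    {X : Scheme.{u}} [IsIntegral X] (π : X ⟶ Spec (.of K)) [IsProper π]
    [SmoothOfRelativeDimension 1 π]
    (x : X) (hx : IsClosed ({x} : Set X))
    (F : X.Modules) (hF : IsVectorBundle F 2)
    (L : Submodule (X.presheaf.stalk x) (ThickFiber (endZero F) x 2))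
    (hL : L ∈ OSigma (traceForm F) 3 x 1)
    (φ : Module.End (X.presheaf.stalk x) (ThickFiber F x 1)) (hφ : φ ≠ 0)
    (hLφ : fiberImage L = (Submodule.span (X.presheaf.stalk x) {φ} : Set _)) :
    (degree π F 2 = 0 →
      IsometricTo (heckeForm (traceForm F) x L)
        (traceForm (twist x (elementary F x 1 (LinearMap.range φ))))) ∧
    (degree π F 2 = 1 →
      IsometricTo (heckeForm (traceForm F) x L)
        (traceForm (elementary F x 1 (LinearMap.range φ)))) := by
  have : IsLocallyNoetherian X := LocallyOfFiniteType.isLocallyNoetherian π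
  have hgen : ∀ p : X, ∃ (V : X.Opens) (t : Γ(X, V)), p ∈ V ∧ IsLocalGenerator x t := fun p ↦ by
    by_cases hp : p = x
    · subst hp
      obtain ⟨V, hV, hpV, t, ht⟩ := exists_maxIdeal_eq_span π p hx
      exact exists_isLocalGenerator hx hV hpV t ht (maxIdeal_ne_bot (by norm_num) hL)
    · exact ⟨⟨{x}ᶜ, hx.isOpen_compl⟩, 1, hp, isLocalGenerator_one fun h ↦ h rfl⟩
  have hmod : ∀ p : X, ∃ (V : X.Opens) (t : Γ(X, V)) (e : Fin 2 → Γ(F, V)),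
      p ∈ V ∧ IsModel (LinearMap.range φ) L t e := fun p ↦ by
    by_cases hp : p = x
    · subst hp
      exact exists_isModel_self hF hgen hL.1 (isUnit_two_stalk hK π p) φ hφ hLφ
    · exact exists_isModel_of_ne hF hx _ L hp
  have h := isometricTo_endZero_elementary hmod hF
  -- The identification with `End₀(F')` is `h`; composing it with the invariance of `End₀` under
  -- twisting gives `End₀(F'(x))`.
  exact ⟨fun _ ↦ h.trans (isometricTo_twist (isVectorBundle_elementary hmod) hgen), fun _ ↦ h⟩
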